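/- Let $E$ be an elliptic curve over $\mathbb C$ given by a Weierstrass equation $y^2+a_1xy+a_3y=x^3+a_2x^2+a_4x+a_6$, with group law $\oplus$ on $E(\mathbb C)$ and identity $O$ the point at infinity. Let $\beta\colon E(\mathbb C)\to\mathbb P^1(\mathbb C)$ be a nonconstant rational function on $E$. For a point $P$ let $e_P=e_\beta(P)$ denote the ramification index, i.e. $\operatorname{ord}_P(\beta-\beta(P))$ if $\beta(P)\neq\infty$ and $\operatorname{ord}_P(1/\beta)$ if $\beta(P)=\infty$; $P$ is a critical point if $e_P\ge 2$, and then $\beta(P)$ is a critical value. Assume that $(E,\beta)$ is a toroidal Belyĭ pair, i.e. all critical values of $\beta$ lie in $\{0,1,\infty\}$, and let $N$ be the degree of $\beta$, i.e. the number of points of $\beta^{-1}(\{q\})$ for $q\in\mathbb P^1(\mathbb C)$ not a critical value. Theorem. The fibres of $\beta$ are finite, and $$\bigoplus_{P\in\beta^{-1}(\{0\})}[e_P]P=\bigoplus_{P\in\beta^{-1}(\{1\})}[e_P]P=\bigoplus_{P\in\beta^{-1}(\{\infty\})}[e_P]P .$$ Denote this common value by $Q_0$. Then there is a point $P_0\in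 E(\mathbb C)$ with $[N]P_0=Q_0$, and there are polynomial functions $f,g\in\mathbb C[E]=\mathbb C[x,y]/(y^2+a_1xy+a_3y-x^3-a_2x^2-a_4x-a_6)$ such that $f$, $g$ and $f-g$ are nonzero, $\beta(P\oplus P_0)=(f/g)(P)$ in $\mathbb P^1(\mathbb C)$ for all $P\in E(\mathbb C)$, and $$\operatorname{div}(f)=\sum_{P\in B}e'_P\,(P)-N\,(O),\qquad \operatorname{div}(f-g)=\sum_{P\in W}e'_P\,(P)-N\,(O),\qquad \operatorname{div}(g)=\sum_{P\in F}e'_P\,(P)-N\,(O),$$ where $B=\beta^{-1}(\{0\})\ominus P_0$, $W=\beta^{-1}(\{1\})\ominus P_0$, $F=\beta^{-1}(\{\infty\})\ominus P_0$, and $e'_P=e_\beta(P\oplus P_0)$ is the ramification index of the translate $\beta(\cdot\oplus P_0)$ at $P$. -/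

import Mathlib

open Polynomial
open scoped Polynomial.Bivariate

noncomputable section

namespace ToroidalBelyi

variable (W : WeierstrassCurve ℂ)

/-- The group `E(ℂ)` of complex points of a Weierstrass curve, with identity the point at infinity
`O = 0`. -/
abbrev Pt : Type := W.toAffine.Point

/-- The function field `K(E)`, i.e. the field of fractions of the ring `ℂ[E]` of polynomial
functions in `x` and `y`. -/
abbrev Fun : Type := W.toAffine.FunctionField

/-- The ring `ℂ[E]` of polynomial functions in `x` and `y`. -/
abbrev PolyFun : Type := W.toAffine.CoordinateRing

/-- The function `x` on `E`. -/
def x : Fun W := algebraMap (PolyFun W) (Fun W) (WeierstrassCurve.Affine.CoordinateRing.mk _ (C X))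

/-- The function `y` on `E`. -/
def y : Fun W := algebraMap (PolyFun W) (Fun W) (WeierstrassCurve.Affine.CoordinateRing.mk _ Y)

variable {W}

/-- A pair of coordinate functions on an affine open part of `E` that contains `P`: the pair
`(x, y)` if `P` is an affine point, and the pair `(x / y, 1 / y)` if `P = O` (in homogeneous
coordinates `[X : Y : Z]`, the coordinates of the part `Y ≠ 0`). -/
def chart : Pt W → Fun W × Fun W
  | .zero => (x W / y W, 1 / y W)
  | .some _ _ _ => (x W, y W)

/-- The coordinates of `P` in the chart `chart P`. -/
def center : Pt W → ℂ × ℂ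
  | .zero => (0, 0)
  | .some a b _ => (a, b)

/-- The polynomial `A`, written in the coordinates of the chart at `P`, as a function on `E`. -/
def toFun (P : Pt W) (A : ℂ[X][Y]) : Fun W := A.aevalAeval (chart P).1 (chart P).2

/-- The value of the polynomial `A`, written in the coordinates of the chart at `P`, at `P`. -/
def evalAt (P : Pt W) (A : ℂ[X][Y]) : ℂ := A.evalEval (center P).1 (center P).2

/-- The ideal `(s - s₀, t - t₀)` of polynomials in the coordinates `(s, t)` of the chart at
`P = (s₀, t₀)`. -/
def pointIdeal (P : Pt W) : Ideal ℂ[X][Y] :=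
  Ideal.span {C (X - C (center P).1), Y - C (C (center P).2)}

/-- The local ring `𝒪_P`: the functions `A / B` with `A`, `B` polynomials in the coordinates at
`P` and `B(P) ≠ 0`. -/
def localRing (P : Pt W) : Set (Fun W) :=
  {φ | ∃ A B : ℂ[X][Y], evalAt P B ≠ 0 ∧ φ = toFun P A / toFun P B}

/-- The power `M_P ^ e` of the maximal ideal of `𝒪_P`: the combinations, with coefficients in
`𝒪_P`, of the monomials `(s - s₀) ^ i * (t - t₀) ^ j` with `i + j = e`, brought to a common
denominator. -/
def maxIdealPow (P : Pt W) (e : ℕ) : Set (Fun W) :=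
  {φ | ∃ A B : ℂ[X][Y], A ∈ pointIdeal P ^ e ∧ evalAt P B ≠ 0 ∧ φ = toFun P A / toFun P B}

open Classical in
/-- The order `ord_P(φ)` of a function `φ ≠ 0` at `P` (the value at `φ = 0` is irrelevant). -/
def ord (P : Pt W) (φ : Fun W) : ℤ :=
  if φ ∈ localRing P then ((sSup {e : ℕ | φ ∈ maxIdealPow P e} : ℕ) : ℤ)
  else -((sSup {e : ℕ | φ⁻¹ ∈ maxIdealPow P e} : ℕ) : ℤ)

open Classical in
/-- The value `φ(P) ∈ ℙ¹(ℂ) = ℂ ∪ {∞}`: it is `A(P) / B(P)` if `φ = A / B` with `B(P) ≠ 0`, and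
`∞` if `φ ∉ 𝒪_P`. -/
def value (φ : Fun W) (P : Pt W) : OnePoint ℂ :=
  if h : ∃ c : ℂ, ∃ A B : ℂ[X][Y],
      evalAt P B ≠ 0 ∧ φ = toFun P A / toFun P B ∧ c = evalAt P A / evalAt P B
  then OnePoint.some h.choose
  else OnePoint.infty

/-- The ramification index `e_φ(P)` of a nonconstant function `φ`: the order at `P` of
`φ - φ(P)` if `φ(P) ≠ ∞`, and of `1 / φ` if `φ(P) = ∞`. -/
def ramificationIndex (φ : Fun W) (P : Pt W) : ℤ :=
  match value φ P with
  | OnePoint.infty => ord P φ⁻¹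
  | OnePoint.some c => ord P (φ - algebraMap ℂ (Fun W) c)

/-- The fibre `φ⁻¹({q})` of the map `φ : E(ℂ) → ℙ¹(ℂ)`. -/
def fiber (φ : Fun W) (q : OnePoint ℂ) : Set (Pt W) := {P | value φ P = q}

/-- `P` is a critical point of `φ`. -/
def IsCriticalPoint (φ : Fun W) (P : Pt W) : Prop := 2 ≤ ramificationIndex φ P

/-- `q` is a critical value of `φ`. -/
def IsCriticalValue (φ : Fun W) (q : OnePoint ℂ) : Prop :=
  ∃ P, IsCriticalPoint φ P ∧ value φ P = q

/-- `φ` has degree `N`: some fibre of `φ` over a point that is not a critical value has `N`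
elements. -/
def HasDegree (φ : Fun W) (N : ℕ) : Prop :=
  ∃ q : OnePoint ℂ, ¬ IsCriticalValue φ q ∧ (fiber φ q).ncard = N

/-- `φ` is a Belyi map: it is nonconstant, with critical values contained in `{0, 1, ∞}`. -/
def IsBelyiMap (φ : Fun W) : Prop :=
  φ ∉ Set.range (algebraMap ℂ (Fun W)) ∧
    ∀ q, IsCriticalValue φ q → q ∈ ({OnePoint.some 0, OnePoint.some 1, OnePoint.infty} : Set _)

/-- `⊕ [e_P] P` over the points `P` of the fibre `φ⁻¹({q})`. -/
def fiberSum (φ : Fun W) (q : OnePoint ℂ) : Pt W :=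
  ∑ᶠ P ∈ fiber φ q, ramificationIndex φ P • P

/-- The divisor `∑ e_P (P) - N (O)`, where `P` runs over the translated fibre
`φ⁻¹({q}) ⊖ P₀` and `e_P` is the ramification index of `φ` at the corresponding point `P ⊕ P₀` of
`φ⁻¹({q})`. -/
def translatedFiberDivisor (φ : Fun W) (q : OnePoint ℂ) (P₀ : Pt W) (N : ℕ) : Pt W →₀ ℤ :=
  (∑ᶠ P ∈ (fun P => P - P₀) '' fiber φ q, Finsupp.single P (ramificationIndex φ (P + P₀))) -
    Finsupp.single 0 (N : ℤ)

/-- `div(φ) = D`, for a function `φ` that is not identically zero. -/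
def HasDivisor (φ : Fun W) (D : Pt W →₀ ℤ) : Prop :=
  φ ≠ 0 ∧ ∀ P, ord P φ = D P

end ToroidalBelyi

end

open WeierstrassCurve

noncomputable section

namespace ToroidalBelyi

open WithZero

variable {W : WeierstrassCurve ℂ}

/-! ### Polynomials in the coordinates at a point -/

/-! For a constant `c`, the poles of `β - c` are those of `β`, so `div(β - c)` is the fibre over `c`
minus the fibre over `∞`, both counted with multiplicity. On an elliptic curve a divisor is
principal exactly when it has degree zero and its points add up to `O`. Hence all fibres have the
same degree, which is `N`, and the same sum `Q₀`. Since `E(ℂ)` is divisible, `Q₀ = N P₀`. Moving the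
fibre over `q` by `-P₀` and subtracting `N (O)` gives a divisor `E_q` of degree zero and sum `Q₀ - N
P₀ = O`. Let `g` have divisor `E_∞` and let `f` be `g` times the translate of `β`. Then `f - c g`
has divisor `E_c`; the cases `c = 0, 1` give `f` and `f - g`. Both `f` and `g` are polynomial
functions because they have no pole outside `O`.

Four facts carry this. The explicit `ord` and `value` are those of a discrete valuation
(`IsPlaceAt.ord_eq`, `IsPlaceAt.value_eq_some_iff`). The criterion for principal divisors
(`sum_divisor`, `sum_divisor_smul`, `exists_divisor_eq`) comes from the injection of `E(ℂ)` into the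
class group of the Dedekind domain `ℂ[E]`, with degrees read off from the norm to `ℂ[x]`.
Translations act on functions compatibly with the valuations (`exists_translation`), and
multiplication by `n ≠ 0` is onto (`nsmul_surjective`). The last two use the generic point `(x, y)`,
a point of `E` over its own function field, whose translates and multiples specialize correctly at
almost every complex point. -/

lemma algHom_ext_XY {A : Type*} [CommRing A] [Algebra ℂ A] {φ ψ : ℂ[X][Y] →ₐ[ℂ] A}
    (hX : φ (C X) = ψ (C X)) (hY : φ Y = ψ Y) : φ = ψ :=
  (aevalAevalEquiv ℂ A).symm.injective (Prod.ext hX hY)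

lemma aevalAeval_mem {A : Type*} [CommRing A] [Algebra ℂ A] (S : Subalgebra ℂ A) {a b : A}
    (ha : a ∈ S) (hb : b ∈ S) (p : ℂ[X][Y]) : aevalAeval a b p ∈ S := by
  have : aevalAeval a b = S.val.comp (aevalAeval (⟨a, ha⟩ : S) ⟨b, hb⟩) := by
    apply algHom_ext_XY
    · rw [aevalAeval_X, AlgHom.comp_apply, aevalAeval_X]; rfl
    · rw [aevalAeval_Y, AlgHom.comp_apply, aevalAeval_Y]; rfl
  rw [this]
  exact Subtype.prop _

/-- A polynomial in `x` and `y` as a function on `E`. -/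
def polyHom (W : WeierstrassCurve ℂ) : ℂ[X][Y] →ₐ[ℂ] Fun W :=
  (IsScalarTower.toAlgHom ℂ (PolyFun W) (Fun W)).comp
    ((AdjoinRoot.mkₐ W.toAffine.polynomial).restrictScalars ℂ)

lemma polyHom_apply (A : ℂ[X][Y]) : polyHom W A =
    algebraMap (PolyFun W) (Fun W) (Affine.CoordinateRing.mk W.toAffine A) := rfl

lemma polyHom_eq : polyHom W = aevalAeval (x W) (y W) :=
  algHom_ext_XY (aevalAeval_X _ _).symm (aevalAeval_Y _ _).symm

lemma polyHom_polynomial : polyHom W W.toAffine.polynomial = 0 := by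
  have : Affine.CoordinateRing.mk W.toAffine W.toAffine.polynomial = 0 := AdjoinRoot.mk_self
  rw [polyHom_apply, this, map_zero]

/-- The polynomials in the coordinates at `P`, mapped to functions on `E`. -/
def toFunHom (P : Pt W) : ℂ[X][Y] →ₐ[ℂ] Fun W := aevalAeval (chart P).1 (chart P).2

lemma toFun_eq (P : Pt W) (A : ℂ[X][Y]) : toFun P A = toFunHom P A := rfl

lemma toFunHom_X (P : Pt W) : toFunHom P (C X) = (chart P).1 := aevalAeval_X _ _

lemma toFunHom_Y (P : Pt W) : toFunHom P Y = (chart P).2 := aevalAeval_Y _ _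

lemma toFunHom_CC (P : Pt W) (c : ℂ) : toFunHom P (C (C c)) = algebraMap ℂ (Fun W) c :=
  (toFunHom P).commutes c

lemma evalAt_eq (P : Pt W) (A : ℂ[X][Y]) :
    evalAt P A = evalEvalRingHom (center P).1 (center P).2 A := rfl

lemma evalAt_CC (P : Pt W) (c : ℂ) : evalAt P (C (C c)) = c := evalEval_CC _ _ c

lemma mem_pointIdeal {P : Pt W} {A : ℂ[X][Y]} : A ∈ pointIdeal P ↔ evalAt P A = 0 :=
  mem_span_C_X_sub_C_X_sub_C_iff_eval_eval_eq_zero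

lemma toFunHom_some {a b : ℂ} (h : W.toAffine.Nonsingular a b) (A : ℂ[X][Y]) :
    toFunHom (.some a b h : Pt W) A =
      algebraMap (PolyFun W) (Fun W) (Affine.CoordinateRing.mk W.toAffine A) := by
  have : toFunHom (.some a b h : Pt W) = polyHom W :=
    algHom_ext_XY (toFunHom_X _) (toFunHom_Y _)
  rw [this]
  rfl

lemma equation_x_y (W : WeierstrassCurve ℂ) :
    y W ^ 2 + algebraMap ℂ _ W.a₁ * x W * y W + algebraMap ℂ _ W.a₃ * y W =
      x W ^ 3 + algebraMap ℂ _ W.a₂ * x W ^ 2 + algebraMap ℂ _ W.a₄ * x W +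
        algebraMap ℂ _ W.a₆ := by
  have hx : polyHom W (C X) = x W := rfl
  have hy : polyHom W Y = y W := rfl
  have hc (c : ℂ) : polyHom W (C (C c)) = algebraMap ℂ _ c := (polyHom W).commutes c
  have h0 : polyHom W (Y ^ 2 + C (C W.a₁ * X + C W.a₃) * Y -
    C (X ^ 3 + C W.a₂ * X ^ 2 + C W.a₄ * X + C W.a₆)) = 0 := polyHom_polynomial
  simp only [map_add, map_mul, map_sub, map_pow, hx, hy, hc] at h0
  linear_combination h0

lemma y_ne_zero (W : WeierstrassCurve ℂ) : y W ≠ 0 := by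
  have h := Affine.CoordinateRing.YClass_ne_zero (W' := W.toAffine) 0
  rw [Affine.CoordinateRing.YClass, C_0, sub_zero] at h
  exact fun h0 => h ((map_eq_zero_iff _ (IsFractionRing.injective (PolyFun W) (Fun W))).1 h0)

/-- Every function is a quotient of polynomials in `x` and `y`. -/
lemma exists_eq_div (φ : Fun W) : ∃ r s : PolyFun W, s ≠ 0 ∧
    φ = algebraMap _ (Fun W) r / algebraMap _ (Fun W) s := by
  obtain ⟨r, s, hs, h⟩ := IsFractionRing.div_surjective (A := PolyFun W) φ
  exact ⟨r, s, nonZeroDivisors.ne_zero hs, h.symm⟩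

lemma algebraMap_polyFun_ne_zero {r : PolyFun W} (hr : r ≠ 0) : algebraMap _ (Fun W) r ≠ 0 :=
  (map_ne_zero_iff _ (IsFractionRing.injective (PolyFun W) (Fun W))).2 hr

/-- A polynomial in `x` and `y` becomes a polynomial in `x / y` and `1 / y` after multiplication
by a power of `1 / y`. -/
lemma exists_toFunHom_zero_eq (A : ℂ[X][Y]) : ∃ (n : ℕ) (B : ℂ[X][Y]),
    toFunHom (0 : Pt W) B = aevalAeval (x W) (y W) A * (1 / y W) ^ n := by
  have ht : toFunHom (0 : Pt W) Y = 1 / y W := toFunHom_Y _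
  have hs : toFunHom (0 : Pt W) (C X) = x W / y W := toFunHom_X _
  have hy := y_ne_zero W
  -- The functions whose denominators can be cleared in this way form a subalgebra, so it is enough
  -- to treat `x` and `y`.
  let S : Subalgebra ℂ (Fun W) :=
    { carrier := {φ | ∃ (n : ℕ) (B : ℂ[X][Y]), toFunHom (0 : Pt W) B = φ * (1 / y W) ^ n}
      mul_mem' := by
        rintro φ ψ ⟨m, B, hB⟩ ⟨n, D, hD⟩
        exact ⟨m + n, B * D, by rw [map_mul, hB, hD]; ring⟩
      add_mem' := by
        rintro φ ψ ⟨m, B, hB⟩ ⟨n, D, hD⟩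
        exact ⟨m + n, B * Y ^ n + D * Y ^ m, by
          rw [map_add, map_mul, map_mul, map_pow, map_pow, hB, hD, ht]; ring⟩
      algebraMap_mem' := fun c => ⟨0, C (C c), by rw [toFunHom_CC, pow_zero, mul_one]⟩ }
  have hxS : x W ∈ S := ⟨1, C X, by rw [hs]; ring⟩
  have hyS : y W ∈ S := ⟨1, 1, by rw [map_one, pow_one, mul_one_div_cancel hy]⟩
  exact aevalAeval_mem S hxS hyS A

lemma exists_toFun_div (P : Pt W) (φ : Fun W) :
    ∃ A B : ℂ[X][Y], toFunHom P B ≠ 0 ∧ φ = toFunHom P A / toFunHom P B := by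
  obtain ⟨r, s, hs, rfl⟩ := exists_eq_div φ
  obtain ⟨A, rfl⟩ := AdjoinRoot.mk_surjective r
  obtain ⟨B, rfl⟩ := AdjoinRoot.mk_surjective s
  have hs' := algebraMap_polyFun_ne_zero hs
  match P with
  | .some a b h => exact ⟨A, B, by rwa [toFunHom_some h], by rw [toFunHom_some, toFunHom_some]⟩
  | .zero =>
    have key (A : ℂ[X][Y]) : algebraMap (PolyFun W) (Fun W)
        (AdjoinRoot.mk W.toAffine.polynomial A) = aevalAeval (x W) (y W) A :=  by
      rw [← polyHom_eq]
      rfl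
    obtain ⟨m, A', hA⟩ := exists_toFunHom_zero_eq (W := W) A
    obtain ⟨n, B', hB⟩ := exists_toFunHom_zero_eq (W := W) B
    have ht : toFunHom (0 : Pt W) Y = 1 / y W := toFunHom_Y _
    have hy : 1 / y W ≠ 0 := one_div_ne_zero (y_ne_zero W)
    refine ⟨A' * Y ^ n, B' * Y ^ m, ?_, ?_⟩
    · change toFunHom (0 : Pt W) _ ≠ 0
      rw [map_mul, map_pow, hB, ht, ← key]
      exact mul_ne_zero (mul_ne_zero hs' (pow_ne_zero _ hy)) (pow_ne_zero _ hy)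
    · change _ = toFunHom (0 : Pt W) _ / toFunHom (0 : Pt W) _
      rw [map_mul, map_mul, map_pow, map_pow, hA, hB, ht, ← key, ← key]
      field_simp

/-- The ideal of a nonsingular point is locally principal. -/
lemma exists_local_generator (P : Pt W) : ∃ π ∈ pointIdeal P, ∀ A ∈ pointIdeal P,
    ∃ U V : ℂ[X][Y], evalAt P U ≠ 0 ∧
      toFunHom P U * toFunHom P A = toFunHom P V * toFunHom P π := by
  -- A relation `U h = V g` with `U(P) ≠ 0` makes `h` a multiple of `g` in the local ring, so `g`
  -- alone generates.
  suffices H : ∃ g h U V : ℂ[X][Y], pointIdeal P = Ideal.span {g, h} ∧ evalAt P U ≠ 0 ∧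
      toFunHom P U * toFunHom P h = toFunHom P V * toFunHom P g by
    obtain ⟨g, h, U, V, hI, hU, hUV⟩ := H
    refine ⟨g, hI ▸ Ideal.subset_span (Set.mem_insert _ _), fun A hA => ?_⟩
    rw [hI, Ideal.mem_span_pair] at hA
    obtain ⟨c, d, rfl⟩ := hA
    refine ⟨U, U * c + d * V, hU, ?_⟩
    simp only [map_add, map_mul]
    linear_combination toFunHom P d * hUV
  match P with
  | .zero =>
    -- With `s = x / y` and `t = 1 / y` the Weierstrass equation reads `t (1 + a₁ s + a₃ t - a₂ s² -
    -- a₄ s t - a₆ t²) = s³`. The factor in brackets is `1` at `O`, so `s` is a generator.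
    refine ⟨C (X - C 0), Y - C (C 0), 1 + C (C W.a₁) * C X + C (C W.a₃) * Y
      - C (C W.a₂) * C X ^ 2 - C (C W.a₄) * C X * Y - C (C W.a₆) * Y ^ 2, C X ^ 2, rfl, ?_, ?_⟩
    · rw [evalAt_eq]
      simp [center]
    · have e := equation_x_y W
      have hy := y_ne_zero W
      simp only [map_sub, map_add, map_mul, map_pow, map_one, toFunHom_X, toFunHom_Y, toFunHom_CC,
        chart, map_zero, sub_zero]
      field_simp
      linear_combination e
  | .some a b h =>
    have e := equation_x_y W
    have e' : b ^ 2 + W.a₁ * a * b + W.a₃ * b = a ^ 3 + W.a₂ * a ^ 2 + W.a₄ * a + W.a₆ :=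
      (Affine.equation_iff _ _).1 h.1
    have e'' := congrArg (algebraMap ℂ (Fun W)) e'
    simp only [map_add, map_mul, map_pow] at e''
    -- Subtracting the equation at `(a, b)` from the generic one and factoring gives `U (y - b) = V
    -- (x - a)`. At the point, `U` and `V` take the values of the `Y`-derivative and of minus the
    -- `X`-derivative of the curve polynomial; nonsingularity makes one of them nonzero.
    set U : ℂ[X][Y] := Y + C (C (b + W.a₁ * a + W.a₃))
    set V : ℂ[X][Y] := C X ^ 2 + C (C (a + W.a₂)) * C X + C (C (a ^ 2 + W.a₂ * a + W.a₄))
      - C (C W.a₁) * Y with hV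
    have key : toFunHom (.some a b h : Pt W) U * toFunHom (.some a b h : Pt W) (Y - C (C b)) =
        toFunHom (.some a b h : Pt W) V * toFunHom (.some a b h : Pt W) (C (X - C a)) := by
      simp only [U, V, map_sub, map_add, map_mul, map_pow, toFunHom_X, toFunHom_Y, toFunHom_CC,
        chart]
      linear_combination e - e''
    have hU0 : evalAt (.some a b h : Pt W) U = 2 * b + W.a₁ * a + W.a₃ := by
      rw [evalAt_eq]
      simp [U, center]
      ring
    have hV0 : evalAt (.some a b h : Pt W) V = 3 * a ^ 2 + 2 * W.a₂ * a + W.a₄ - W.a₁ * b := by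
      rw [evalAt_eq]
      simp [V, center]
      ring
    rcases ((Affine.nonsingular_iff' _ _).1 h).2 with h1 | h1
    · refine ⟨Y - C (C b), C (X - C a), V, U, Set.pair_comm _ _ ▸ rfl, ?_, key.symm⟩
      rw [hV0]
      contrapose! h1
      linear_combination -h1
    · exact ⟨C (X - C a), Y - C (C b), U, V, rfl, by rwa [hU0], key⟩

/-! ### Places -/

/-- `v` is the discrete valuation of the function field centered at `P`. -/
structure IsPlaceAt (v : Valuation (Fun W) (WithZero (Multiplicative ℤ))) (P : Pt W) : Prop where
  const_le : ∀ c : ℂ, v (algebraMap ℂ (Fun W) c) ≤ 1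
  fst_lt : v ((chart P).1 - algebraMap ℂ (Fun W) (center P).1) < 1
  snd_lt : v ((chart P).2 - algebraMap ℂ (Fun W) (center P).2) < 1
  exists_uniformizer : ∃ ϖ, v ϖ = exp (-1 : ℤ)

lemma exp_neg_one_lt : (exp (-1 : ℤ) : WithZero (Multiplicative ℤ)) < 1 := by
  rw [← exp_zero, exp_lt_exp]; norm_num

lemma lt_one_iff_le_exp {a : WithZero (Multiplicative ℤ)} : a < 1 ↔ a ≤ exp (-1 : ℤ) := by
  rw [← lt_mul_exp_iff_le exp_ne_zero, ← exp_add]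
  simp

lemma const_eq_one {v : Valuation (Fun W) (WithZero (Multiplicative ℤ))}
    (hv : ∀ c : ℂ, v (algebraMap ℂ (Fun W) c) ≤ 1) {c : ℂ} (hc : c ≠ 0) :
    v (algebraMap ℂ (Fun W) c) = 1 := by
  have h : v (algebraMap ℂ (Fun W) c) * v (algebraMap ℂ (Fun W) c⁻¹) = 1 := by
    rw [← map_mul, ← map_mul, mul_inv_cancel₀ hc, map_one, map_one]
  refine le_antisymm (hv c) ?_
  calc 1 = v (algebraMap ℂ (Fun W) c) * v (algebraMap ℂ (Fun W) c⁻¹) := h.symm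
    _ ≤ v (algebraMap ℂ (Fun W) c) * 1 := mul_le_mul_right (hv _) _
    _ = _ := mul_one _

namespace IsPlaceAt

variable {v w : Valuation (Fun W) (WithZero (Multiplicative ℤ))} {P Q : Pt W}

lemma const_eq (hv : IsPlaceAt v P) {c : ℂ} (hc : c ≠ 0) : v (algebraMap ℂ (Fun W) c) = 1 :=
  const_eq_one hv.const_le hc

lemma toFunHom_le (hv : IsPlaceAt v P) (A : ℂ[X][Y]) : v (toFunHom P A) ≤ 1 := by
  have aux {φ : Fun W} {c : ℂ} (h : v (φ - algebraMap ℂ _ c) < 1) : φ ∈ v.integer := by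
    have := v.integer.add_mem (show φ - algebraMap ℂ _ c ∈ v.integer from h.le) (hv.const_le c)
    rwa [sub_add_cancel] at this
  let S : Subalgebra ℂ (Fun W) := { v.integer with algebraMap_mem' := hv.const_le }
  have hX : (chart P).1 ∈ S := aux hv.fst_lt
  have hY : (chart P).2 ∈ S := aux hv.snd_lt
  exact aevalAeval_mem S hX hY A

lemma toFunHom_lt (hv : IsPlaceAt v P) {A : ℂ[X][Y]} (hA : evalAt P A = 0) :
    v (toFunHom P A) < 1 := by
  obtain ⟨a, b, rfl⟩ := Ideal.mem_span_pair.1 (mem_pointIdeal.2 hA)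
  rw [map_add, map_mul, map_mul, C_sub, map_sub, map_sub, toFunHom_X, toFunHom_Y, toFunHom_CC,
    toFunHom_CC]
  refine v.map_add_lt ?_ ?_
  · rw [map_mul]
    exact (mul_le_of_le_one_left' (hv.toFunHom_le a)).trans_lt hv.fst_lt
  · rw [map_mul]
    exact (mul_le_of_le_one_left' (hv.toFunHom_le b)).trans_lt hv.snd_lt

lemma toFunHom_eq_one (hv : IsPlaceAt v P) {A : ℂ[X][Y]} (hA : evalAt P A ≠ 0) :
    v (toFunHom P A) = 1 := by
  have h : v (toFunHom P (A - C (C (evalAt P A)))) < 1 := by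
    apply hv.toFunHom_lt
    rw [evalAt_eq, map_sub, ← evalAt_eq, ← evalAt_eq, evalAt_CC, sub_self]
  rw [map_sub, toFunHom_CC] at h
  rw [← hv.const_eq hA]
  exact v.map_eq_of_sub_lt (by rwa [hv.const_eq hA])

lemma evalAt_eq_zero_iff (hv : IsPlaceAt v P) {A : ℂ[X][Y]} :
    evalAt P A = 0 ↔ v (toFunHom P A) < 1 :=
  ⟨hv.toFunHom_lt, fun h => by_contra fun h0 => h.ne (hv.toFunHom_eq_one h0)⟩

lemma toFunHom_ne_zero (hv : IsPlaceAt v P) {A : ℂ[X][Y]} (hA : evalAt P A ≠ 0) :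
    toFunHom P A ≠ 0 := by
  intro h
  have := hv.toFunHom_eq_one hA
  rw [h, map_zero] at this
  exact zero_ne_one this

lemma toFunHom_mem_pow_le (hv : IsPlaceAt v P) {e : ℕ} {A : ℂ[X][Y]} (hA : A ∈ pointIdeal P ^ e) :
    v (toFunHom P A) ≤ exp (-(e : ℤ)) := by
  induction e generalizing A with
  | zero => simpa using hv.toFunHom_le A
  | succ e ih =>
    rw [Submodule.pow_succ] at hA
    induction hA using Submodule.mul_induction_on' with
    | mem_mul_mem a ha b hb =>
      rw [map_mul, map_mul, Nat.cast_succ, neg_add, exp_add]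
      exact mul_le_mul' (ih ha) (lt_one_iff_le_exp.1 (hv.toFunHom_lt (mem_pointIdeal.1 hb)))
    | add a _ b _ ha hb =>
      rw [map_add]
      exact v.map_add_le ha hb

lemma evalAt_mul_ne_zero {A B : ℂ[X][Y]} (hA : evalAt P A ≠ 0) (hB : evalAt P B ≠ 0) :
    evalAt P (A * B) ≠ 0 := by
  rw [evalAt_eq, map_mul]
  exact mul_ne_zero hA hB

/-- A local generator of the ideal of `P` has valuation `exp (-1)`. -/
lemma exists_generator_pow (hv : IsPlaceAt v P) : ∃ π ∈ pointIdeal P, v (toFunHom P π) = exp (-1 : ℤ) ∧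
    ∀ (n : ℕ) (A : ℂ[X][Y]), v (toFunHom P A) ≤ exp (-(n : ℤ)) →
      ∃ U V : ℂ[X][Y], evalAt P U ≠ 0 ∧
        toFunHom P U * toFunHom P A = toFunHom P V * toFunHom P π ^ n := by
  obtain ⟨π, hπ, H⟩ := exists_local_generator P
  have hπ1 : v (toFunHom P π) ≤ exp (-1 : ℤ) :=
    lt_one_iff_le_exp.1 (hv.toFunHom_lt (mem_pointIdeal.1 hπ))
  -- Factors `π` are split off one at a time: while the valuation is small enough, the cofactor `V`
  -- vanishes at `P` and is again locally a multiple of `π`.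
  have step : ∀ (n : ℕ) (A : ℂ[X][Y]), v (toFunHom P A) ≤ v (toFunHom P π) ^ n →
      toFunHom P π ≠ 0 →
      ∃ U V : ℂ[X][Y], evalAt P U ≠ 0 ∧
        toFunHom P U * toFunHom P A = toFunHom P V * toFunHom P π ^ n := by
    intro n
    induction n with
    | zero => exact fun A _ _ => ⟨1, A, by simp [evalAt_eq], by simp⟩
    | succ n ih =>
      intro A hA h0
      have hvπ : v (toFunHom P π) ≠ 0 := v.ne_zero_iff.2 h0
      have hlt : v (toFunHom P π) < 1 := lt_one_iff_le_exp.2 hπ1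
      obtain ⟨U, V, hU, hUV⟩ := ih A (hA.trans (pow_le_pow_right_of_le_one' hlt.le n.le_succ)) h0
      have hV : v (toFunHom P V) < 1 := by
        have := congrArg v hUV
        rw [map_mul, map_mul, hv.toFunHom_eq_one hU, one_mul, map_pow] at this
        rw [this, pow_succ', mul_le_mul_iff_left₀ (zero_lt_iff.2 (pow_ne_zero _ hvπ))] at hA
        exact hA.trans_lt hlt
      obtain ⟨U', V', hU', hUV'⟩ := H V (mem_pointIdeal.2 (hv.evalAt_eq_zero_iff.2 hV))
      refine ⟨U' * U, V', evalAt_mul_ne_zero hU' hU, ?_⟩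
      rw [map_mul, pow_succ']
      linear_combination toFunHom P U' * hUV + toFunHom P π ^ n * hUV'
  -- If `π` were zero as a function, every polynomial in the coordinates would have valuation `0` or
  -- `1`, and no quotient could be a uniformizer.
  have h0 : toFunHom P π ≠ 0 := by
    intro h0
    obtain ⟨ϖ, hϖ⟩ := hv.exists_uniformizer
    obtain ⟨A, B, hB, rfl⟩ := exists_toFun_div P ϖ
    have aux (A : ℂ[X][Y]) : v (toFunHom P A) = 1 ∨ v (toFunHom P A) = 0 := by
      by_cases hA : evalAt P A = 0
      · obtain ⟨U, V, hU, hUV⟩ := H A (mem_pointIdeal.2 hA)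
        rw [h0, mul_zero] at hUV
        right
        rw [(mul_eq_zero.1 hUV).resolve_left (hv.toFunHom_ne_zero hU), map_zero]
      · exact Or.inl (hv.toFunHom_eq_one hA)
    rw [map_div₀, (aux B).resolve_right (v.ne_zero_iff.2 hB), div_one] at hϖ
    rcases aux A with h | h
    · exact exp_neg_one_lt.ne (hϖ.symm.trans h)
    · exact exp_ne_zero (hϖ.symm.trans h)
  have hvπ : v (toFunHom P π) ≠ 0 := v.ne_zero_iff.2 h0
  -- Otherwise `π` could be split off indefinitely, against the discreteness of `v`.
  have hpow (A : ℂ[X][Y]) (hA : toFunHom P A ≠ 0) : ∃ n : ℕ,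
      v (toFunHom P A) = v (toFunHom P π) ^ n := by
    by_contra! hne
    have hle : ∀ n : ℕ, v (toFunHom P A) ≤ v (toFunHom P π) ^ n := by
      intro n
      induction n with
      | zero => simpa using hv.toFunHom_le A
      | succ n ih =>
        obtain ⟨U, V, hU, hUV⟩ := step n A ih h0
        have h1 := congrArg v hUV
        rw [map_mul, map_mul, hv.toFunHom_eq_one hU, one_mul, map_pow] at h1
        have hV : evalAt P V = 0 := by
          by_contra hV
          rw [hv.toFunHom_eq_one hV, one_mul] at h1
          exact hne n h1
        obtain ⟨U', V', hU', hUV'⟩ := H V (mem_pointIdeal.2 hV)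
        have h2 := congrArg v hUV'
        rw [map_mul, map_mul, hv.toFunHom_eq_one hU', one_mul] at h2
        rw [h1, h2, pow_succ', mul_assoc]
        exact mul_le_of_le_one_left' (hv.toFunHom_le V')
    obtain ⟨k, hk⟩ : ∃ k : ℕ, exp (-(k : ℤ)) < v (toFunHom P A) :=
      ⟨(-(v (toFunHom P A)).log + 1).toNat, by
        rw [← lt_log_iff_exp_lt (v.ne_zero_iff.2 hA)]; omega⟩
    refine (hk.trans_le (hle k)).not_ge ?_
    calc v (toFunHom P π) ^ k ≤ exp (-1 : ℤ) ^ k := pow_le_pow_left' hπ1 k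
      _ = exp (-(k : ℤ)) := by rw [← exp_nsmul]; simp
  -- All values are powers of `v π`, and `exp (-1)` is one of them, so `log (v π)` is a unit of `ℤ`;
  -- it is negative.
  have hπ' : v (toFunHom P π) = exp (-1 : ℤ) := by
    refine le_antisymm hπ1 ?_
    obtain ⟨ϖ, hϖ⟩ := hv.exists_uniformizer
    obtain ⟨A, B, hB, rfl⟩ := exists_toFun_div P ϖ
    have hA : toFunHom P A ≠ 0 := by
      rintro h
      rw [h, zero_div, map_zero] at hϖ
      exact exp_ne_zero hϖ.symm
    obtain ⟨m, hm⟩ := hpow A hA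
    obtain ⟨n, hn⟩ := hpow B hB
    rw [map_div₀, hm, hn] at hϖ
    have hl := congrArg log hϖ
    rw [log_div (pow_ne_zero _ hvπ) (pow_ne_zero _ hvπ), log_pow, log_pow, log_exp, nsmul_eq_mul,
      nsmul_eq_mul, ← sub_mul] at hl
    rw [← le_log_iff_exp_le hvπ]
    have := Int.isUnit_iff.1 (IsUnit.of_mul_eq_one (-((m : ℤ) - n))
      (show (v (toFunHom P π)).log * -((m : ℤ) - n) = 1 by linarith))
    rcases this with h | h <;> omega
  refine ⟨π, hπ, hπ', fun n A hA => step n A ?_ h0⟩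
  rw [hπ', ← exp_nsmul]
  simpa using hA

/-- This is the bridge from the explicit local ring to the valuation: `ord` and `value` are computed
through it. -/
lemma mem_maxIdealPow_iff (hv : IsPlaceAt v P) {e : ℕ} {φ : Fun W} :
    φ ∈ maxIdealPow P e ↔ v φ ≤ exp (-(e : ℤ)) := by
  constructor
  · rintro ⟨A, B, hA, hB, rfl⟩
    rw [toFun_eq, toFun_eq, map_div₀, hv.toFunHom_eq_one hB, div_one]
    exact hv.toFunHom_mem_pow_le hA
  · intro h
    obtain ⟨A, B, hB, rfl⟩ := exists_toFun_div P φ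
    obtain ⟨π, hπ, hvπ, H⟩ := hv.exists_generator_pow
    have hπ0 : toFunHom P π ≠ 0 := v.ne_zero_iff.1 (hvπ ▸ exp_ne_zero)
    have hB0 : v (toFunHom P B) ≠ 0 := v.ne_zero_iff.2 hB
    obtain ⟨m, hm⟩ : ∃ m : ℕ, v (toFunHom P B) = exp (-(m : ℤ)) := by
      refine ⟨(-(v (toFunHom P B)).log).toNat, ?_⟩
      have : (v (toFunHom P B)).log ≤ 0 := by
        rw [log_le_iff_le_exp hB0]; exact hv.toFunHom_le B
      rw [Int.toNat_of_nonneg (by omega), neg_neg, exp_log hB0]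
    obtain ⟨U, V, hU, hUV⟩ := H m B hm.le
    -- The exponent `m` is the exact order of `B`, so nothing vanishing at `P` is left after
    -- splitting off `π ^ m`.
    have hV : evalAt P V ≠ 0 := by
      intro hV
      have h1 := congrArg v hUV
      rw [map_mul, map_mul, hv.toFunHom_eq_one hU, one_mul, map_pow, hvπ, hm, ← exp_nsmul,
        nsmul_eq_mul, mul_neg, mul_one] at h1
      exact (hv.toFunHom_lt hV).ne (mul_right_cancel₀ exp_ne_zero (h1.symm.trans (one_mul _).symm))
    have hA : v (toFunHom P A) ≤ exp (-((m + e : ℕ) : ℤ)) := by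
      rw [map_div₀, hm, div_le_iff₀ (zero_lt_iff.2 exp_ne_zero), ← exp_add] at h
      convert h using 2
      push_cast
      ring
    obtain ⟨U', V', hU', hUV'⟩ := H (m + e) A hA
    have hU0 := hv.toFunHom_ne_zero hU
    have hU0' := hv.toFunHom_ne_zero hU'
    have hV0 := hv.toFunHom_ne_zero hV
    -- From `U B = V π ^ m` and `U' A = V' π ^ (m + e)` follows `A / B = V' U π ^ e / (U' V)`.
    refine ⟨V' * U * π ^ e, U' * V, Ideal.mul_mem_left _ _ (Ideal.pow_mem_pow hπ e),
      evalAt_mul_ne_zero hU' hV, ?_⟩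
    simp only [toFun_eq, map_mul, map_pow]
    rw [div_eq_div_iff hB (mul_ne_zero hU0' hV0)]
    apply mul_left_cancel₀ (pow_ne_zero m hπ0)
    linear_combination toFunHom P V * toFunHom P π ^ m * hUV' -
      toFunHom P V' * toFunHom P π ^ (m + e) * hUV

lemma mem_localRing_iff (hv : IsPlaceAt v P) {φ : Fun W} : φ ∈ localRing P ↔ v φ ≤ 1 := by
  have : φ ∈ localRing P ↔ φ ∈ maxIdealPow P 0 := by simp [localRing, maxIdealPow]
  rw [this, hv.mem_maxIdealPow_iff]
  simp

/-- The order of a function in terms of the valuation at the point. -/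
lemma ord_eq (hv : IsPlaceAt v P) (φ : Fun W) : ord P φ = -log (v φ) := by
  have aux (ψ : Fun W) (h0 : v ψ ≠ 0) (h1 : v ψ ≤ 1) :
      ((sSup {e : ℕ | ψ ∈ maxIdealPow P e} : ℕ) : ℤ) = -log (v ψ) := by
    have hle : (v ψ).log ≤ 0 := by rw [log_le_iff_le_exp h0]; exact h1
    have : {e : ℕ | ψ ∈ maxIdealPow P e} = Set.Iic (-(v ψ).log).toNat := by
      ext e
      rw [Set.mem_ofPred_eq, hv.mem_maxIdealPow_iff, ← log_le_iff_le_exp h0, Set.mem_Iic]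
      omega
    rw [this, csSup_Iic, Int.toNat_of_nonneg (by omega)]
  rw [ord]
  split_ifs with h
  · rw [hv.mem_localRing_iff] at h
    by_cases h0 : v φ = 0
    -- For `φ = 0` the default values agree: the supremum of all of `ℕ` is `0`, and so is `log 0`.
    · have : {e : ℕ | φ ∈ maxIdealPow P e} = Set.univ := by
        ext e
        simp [hv.mem_maxIdealPow_iff, h0]
      simp [this, h0]
    · exact aux φ h0 h
  · rw [hv.mem_localRing_iff, not_le] at h
    rw [aux φ⁻¹ (by rw [map_inv₀]; exact inv_ne_zero (zero_lt_one.trans h).ne')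
      (by rw [map_inv₀]; exact inv_le_one_of_one_le₀ h.le), map_inv₀, log_inv, neg_neg]

/-- The value of a function in terms of the valuation at the point. -/
lemma value_eq_some_iff (hv : IsPlaceAt v P) {φ : Fun W} {c : ℂ} :
    value φ P = OnePoint.some c ↔ v (φ - algebraMap ℂ _ c) < 1 := by
  have key {c : ℂ} (h : ∃ A B : ℂ[X][Y],
      evalAt P B ≠ 0 ∧ φ = toFun P A / toFun P B ∧ c = evalAt P A / evalAt P B) :
      v (φ - algebraMap ℂ _ c) < 1 := by
    obtain ⟨A, B, hB, rfl, rfl⟩ := h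
    have hB0 := hv.toFunHom_ne_zero hB
    have : toFun P A / toFun P B - algebraMap ℂ (Fun W) (evalAt P A / evalAt P B) =
        toFunHom P (A - C (C (evalAt P A / evalAt P B)) * B) / toFunHom P B := by
      rw [map_sub, map_mul, toFunHom_CC, toFun_eq, toFun_eq]
      field_simp
    rw [this, map_div₀, hv.toFunHom_eq_one hB, div_one]
    apply hv.toFunHom_lt
    rw [evalAt_eq, map_sub, map_mul, ← evalAt_eq, ← evalAt_eq, ← evalAt_eq, evalAt_CC,
      div_mul_cancel₀ _ hB, sub_self]
  have uniq {c d : ℂ} (hc : v (φ - algebraMap ℂ _ c) < 1) (hd : v (φ - algebraMap ℂ _ d) < 1) :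
      c = d := by
    by_contra hne
    have h1 := hv.const_eq (sub_ne_zero.2 hne)
    have h2 := v.map_sub_lt hd hc
    rw [sub_sub_sub_cancel_left, ← map_sub] at h2
    exact h2.ne h1
  rw [value]
  split_ifs with h
  · have hc := key h.choose_spec
    constructor
    · intro he
      rwa [← OnePoint.some_eq_iff _ _ |>.1 he]
    · intro h'
      rw [uniq hc h']
  · refine iff_of_false (OnePoint.infty_ne_coe _) fun hc => h ?_
    have h1 : φ ∈ localRing P := by
      rw [hv.mem_localRing_iff]
      have := v.map_add_le hc.le (hv.const_le c)
      rwa [sub_add_cancel] at this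
    obtain ⟨A, B, hB, hφ⟩ := h1
    exact ⟨_, A, B, hB, hφ, rfl⟩

lemma value_eq_infty_iff (hv : IsPlaceAt v P) {φ : Fun W} :
    value φ P = OnePoint.infty ↔ 1 < v φ := by
  rw [value]
  split_ifs with h
  · refine iff_of_false (OnePoint.coe_ne_infty _) ?_
    obtain ⟨c, A, B, hB, hφ, -⟩ := h
    exact not_lt.2 (hv.mem_localRing_iff.1 ⟨A, B, hB, hφ⟩)
  · refine iff_of_true rfl ?_
    by_contra hle
    obtain ⟨A, B, hB, hφ⟩ := hv.mem_localRing_iff.2 (not_lt.1 hle)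
    exact h ⟨_, A, B, hB, hφ, rfl⟩

/-- Two valuations centered at the same point agree. -/
lemma eq (hv : IsPlaceAt v P) (hw : IsPlaceAt w P) : v = w := by
  ext φ
  by_cases h0 : φ = 0
  · simp [h0]
  · have := (hv.ord_eq φ).symm.trans (hw.ord_eq φ)
    rw [← exp_log (v.ne_zero_iff.2 h0), ← exp_log (w.ne_zero_iff.2 h0), neg_injective this]

end IsPlaceAt

end ToroidalBelyi
end

open WeierstrassCurve

noncomputable section

namespace ToroidalBelyi

open WithZero IsDedekindDomain

variable {W : WeierstrassCurve ℂ}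

/-! ### Coordinate functions and the uniqueness of the centre of a valuation -/

lemma algebraMap_XClass (a : ℂ) : algebraMap (PolyFun W) (Fun W)
    (Affine.CoordinateRing.XClass W.toAffine a) = x W - algebraMap ℂ _ a := by
  rw [Affine.CoordinateRing.XClass, ← polyHom_apply, C_sub, map_sub]
  rfl

lemma algebraMap_YClass (b : ℂ) : algebraMap (PolyFun W) (Fun W)
    (Affine.CoordinateRing.YClass W.toAffine (C b)) = y W - algebraMap ℂ _ b := by
  rw [Affine.CoordinateRing.YClass, ← polyHom_apply, map_sub]
  rfl

lemma x_notMem_range : x W ∉ Set.range (algebraMap ℂ (Fun W)) := by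
  rintro ⟨c, hc⟩
  refine algebraMap_polyFun_ne_zero (Affine.CoordinateRing.XClass_ne_zero (W' := W.toAffine) c) ?_
  rw [algebraMap_XClass, hc, sub_self]

lemma constPt_nonsingular {a b : ℂ} (h : W.toAffine.Nonsingular a b) :
    (Affine.baseChange W.toAffine (Fun W)).Nonsingular (algebraMap ℂ (Fun W) a)
      (algebraMap ℂ (Fun W) b) :=
  (Affine.map_nonsingular W.toAffine (algebraMap ℂ (Fun W)).injective a b).2 h

lemma algHom_ext {σ τ : Fun W →ₐ[ℂ] Fun W} (hx : σ (x W) = τ (x W)) (hy : σ (y W) = τ (y W)) :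
    σ = τ := by
  have key (A : ℂ[X][Y]) : σ (polyHom W A) = τ (polyHom W A) := by
    have : σ.comp (polyHom W) = τ.comp (polyHom W) := algHom_ext_XY hx hy
    exact DFunLike.congr_fun this A
  refine AlgHom.ext fun φ => ?_
  obtain ⟨r, s, -, rfl⟩ := exists_eq_div φ
  obtain ⟨A, rfl⟩ := AdjoinRoot.mk_surjective r
  obtain ⟨B, rfl⟩ := AdjoinRoot.mk_surjective s
  rw [map_div₀, map_div₀]
  exact congrArg₂ _ (key A) (key B)

/-- A valuation is centered at no more than one point. -/
lemma IsPlaceAt.point_eq {v : Valuation (Fun W) (WithZero (Multiplicative ℤ))} {P Q : Pt W}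
    (hP : IsPlaceAt v P) (hQ : IsPlaceAt v Q) : P = Q := by
  have aux {a b : ℂ} {h : W.toAffine.Nonsingular a b} (hP : IsPlaceAt v (.some a b h : Pt W)) :
      v (y W) ≤ 1 := by
    have := v.map_add_le hP.snd_lt.le (hP.const_le b)
    change v (y W - algebraMap ℂ (Fun W) b + algebraMap ℂ (Fun W) b) ≤ 1 at this
    rwa [sub_add_cancel] at this
  have aux0 (hP : IsPlaceAt v (.zero : Pt W)) : 1 < v (y W) := by
    have h : v (1 / y W - algebraMap ℂ _ 0) < 1 := hP.snd_lt
    have hy : 0 < v (y W) := zero_lt_iff.2 (v.ne_zero_iff.2 (y_ne_zero W))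
    rwa [map_zero, sub_zero, map_div₀, map_one, div_lt_one₀ hy] at h
  have uniq {φ : Fun W} {c d : ℂ} (hc : v (φ - algebraMap ℂ _ c) < 1)
      (hd : v (φ - algebraMap ℂ _ d) < 1) : c = d := by
    have := (hP.value_eq_some_iff.2 hc).symm.trans (hP.value_eq_some_iff.2 hd)
    exact OnePoint.some_eq_iff _ _ |>.1 this
  match P, Q with
  | .zero, .zero => rfl
  | .zero, .some a b h => exact absurd (aux hQ) (aux0 hP).not_ge
  | .some a b h, .zero => exact absurd (aux hP) (aux0 hQ).not_ge
  | .some a b h, .some a' b' h' =>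
    obtain rfl := uniq hP.fst_lt hQ.fst_lt
    obtain rfl := uniq hP.snd_lt hQ.snd_lt
    rfl

/-! ### The valuation at infinity -/

/-- The norm of `p + q y` has degree `max (2 deg p) (2 deg q + 3)`, and each entry of this maximum
is ultrametric. This makes the degree of the norm a valuation. -/
lemma degree_norm_add_le (r s : PolyFun W) : (Algebra.norm ℂ[X] (r + s)).degree ≤
    max (Algebra.norm ℂ[X] r).degree (Algebra.norm ℂ[X] s).degree := by
  obtain ⟨p, q, rfl⟩ := Affine.CoordinateRing.exists_smul_basis_eq r
  obtain ⟨p', q', rfl⟩ := Affine.CoordinateRing.exists_smul_basis_eq s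
  have h : p • (1 : PolyFun W) + q • Affine.CoordinateRing.mk W.toAffine Y +
      (p' • 1 + q' • Affine.CoordinateRing.mk W.toAffine Y) =
      (p + p') • 1 + (q + q') • Affine.CoordinateRing.mk W.toAffine Y := by
    rw [add_smul, add_smul]; abel
  rw [h, Affine.CoordinateRing.degree_norm_smul_basis, Affine.CoordinateRing.degree_norm_smul_basis,
    Affine.CoordinateRing.degree_norm_smul_basis]
  have hp := degree_add_le p p'
  have hq := degree_add_le q q'
  refine max_le ?_ ?_
  · rcases le_max_iff.1 hp with h | h
    · exact (nsmul_le_nsmul_right h 2).trans ((le_max_left _ _).trans (le_max_left _ _))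
    · exact (nsmul_le_nsmul_right h 2).trans ((le_max_left _ _).trans (le_max_right _ _))
  · rcases le_max_iff.1 hq with h | h
    · exact (add_le_add_left (nsmul_le_nsmul_right h 2) 3).trans
        ((le_max_right _ _).trans (le_max_left _ _))
    · exact (add_le_add_left (nsmul_le_nsmul_right h 2) 3).trans
        ((le_max_right _ _).trans (le_max_right _ _))

lemma norm_XClass (a : ℂ) :
    Algebra.norm ℂ[X] (Affine.CoordinateRing.XClass W.toAffine a) = (X - C a) ^ 2 :=
  Algebra.norm_algebraMap_of_basis (Affine.CoordinateRing.basis W.toAffine) (X - C a)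

lemma norm_ne_zero {r : PolyFun W} (hr : r ≠ 0) : Algebra.norm ℂ[X] r ≠ 0 :=
  (Algebra.norm_ne_zero_iff_of_basis (Affine.CoordinateRing.basis W.toAffine)).2 hr

open Classical in
/-- The valuation at infinity on the coordinate ring: the degree of the norm. -/
def degreeValuation (W : WeierstrassCurve ℂ) :
    Valuation (PolyFun W) (WithZero (Multiplicative ℤ)) where
  toFun r := if r = 0 then 0 else exp ((Algebra.norm ℂ[X] r).natDegree : ℤ)
  map_zero' := if_pos rfl
  map_one' := by simp
  map_mul' r s := by
    by_cases hr : r = 0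
    · simp [hr]
    by_cases hs : s = 0
    · simp [hs]
    simp only [hr, hs, mul_eq_zero, or_self, if_false, map_mul]
    rw [natDegree_mul (norm_ne_zero hr) (norm_ne_zero hs), Nat.cast_add, exp_add]
  map_add_le_max' r s := by
    by_cases hr : r = 0
    · simp [hr]
    by_cases hs : s = 0
    · simp [hs]
    by_cases hrs : r + s = 0
    · simp [hrs]
    simp only [hr, hs, hrs, if_false]
    have := degree_norm_add_le r s
    rw [le_max_iff] at this ⊢
    exact this.imp (fun h => by simpa using natDegree_le_natDegree h)
      (fun h => by simpa using natDegree_le_natDegree h)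

lemma degreeValuation_apply {r : PolyFun W} (hr : r ≠ 0) :
    degreeValuation W r = exp ((Algebra.norm ℂ[X] r).natDegree : ℤ) := if_neg hr

lemma nonZeroDivisors_le_primeCompl :
    nonZeroDivisors (PolyFun W) ≤ (degreeValuation W).supp.primeCompl := by
  intro r hr h
  have hr := nonZeroDivisors.ne_zero hr
  rw [SetLike.mem_coe, Valuation.mem_supp_iff, degreeValuation_apply hr] at h
  exact exp_ne_zero h

/-- The valuation at infinity. -/
def valInfty (W : WeierstrassCurve ℂ) : Valuation (Fun W) (WithZero (Multiplicative ℤ)) :=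
  (degreeValuation W).extendToLocalization nonZeroDivisors_le_primeCompl (Fun W)

lemma valInfty_algebraMap {r : PolyFun W} (hr : r ≠ 0) :
    valInfty W (algebraMap _ _ r) = exp ((Algebra.norm ℂ[X] r).natDegree : ℤ) := by
  rw [valInfty, Valuation.extendToLocalization_apply_map_apply, degreeValuation_apply hr]

/-- The norms of `x` and `y` have degrees `2` and `3`, so `x / y` is a uniformizer and `1 / y`
vanishes to order `3`. -/
lemma isPlaceAt_valInfty : IsPlaceAt (valInfty W) 0 := by
  have hy : valInfty W (y W) = exp (3 : ℤ) := by
    have h := Affine.CoordinateRing.degree_norm_smul_basis (W' := W.toAffine) 0 1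
    simp only [zero_smul, one_smul, zero_add, degree_zero, degree_one, smul_zero] at h
    rw [y, valInfty_algebraMap, natDegree_eq_of_degree_eq_some (n := 3)]
    · rfl
    · rw [h]; rfl
    · intro h0
      exact y_ne_zero W (by rw [y, h0, map_zero])
  have hx : valInfty W (x W) = exp (2 : ℤ) := by
    have h := Affine.CoordinateRing.degree_norm_smul_basis (W' := W.toAffine) X 0
    simp only [zero_smul, add_zero, degree_zero, degree_X, Affine.CoordinateRing.smul,
      mul_one] at h
    rw [x, valInfty_algebraMap, natDegree_eq_of_degree_eq_some (n := 2)]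
    · rfl
    · rw [h]; rfl
    · have := Affine.CoordinateRing.XClass_ne_zero (W' := W.toAffine) 0
      rwa [Affine.CoordinateRing.XClass, C_0, sub_zero] at this
  refine ⟨fun c => ?_, ?_, ?_, x W / y W, ?_⟩
  · by_cases hc : c = 0
    · simp [hc]
    rw [IsScalarTower.algebraMap_apply ℂ (PolyFun W) (Fun W), valInfty_algebraMap,
      IsScalarTower.algebraMap_apply ℂ ℂ[X] (PolyFun W), Algebra.norm_algebraMap,
      Polynomial.algebraMap_apply, natDegree_pow, natDegree_C]
    · simp
    · exact (map_ne_zero_iff _ (FaithfulSMul.algebraMap_injective ℂ (PolyFun W))).2 hc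
  · change valInfty W (x W / y W - algebraMap ℂ _ 0) < 1
    rw [map_zero, sub_zero, map_div₀, hx, hy, ← exp_sub, ← exp_zero, exp_lt_exp]
    norm_num
  · change valInfty W (1 / y W - algebraMap ℂ _ 0) < 1
    rw [map_zero, sub_zero, map_div₀, map_one, hy, ← exp_zero, ← exp_sub, exp_lt_exp]
    norm_num
  · rw [map_div₀, hx, hy, ← exp_sub]
    norm_num

/-! ### Divisors as formal sums -/

/-- The sum of the points of a divisor. -/
def pointSum (W : WeierstrassCurve ℂ) : (Pt W →₀ ℤ) →ₗ[ℤ] Pt W := Finsupp.linearCombination ℤ id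

lemma pointSum_apply (D : Pt W →₀ ℤ) : pointSum W D = D.sum fun P n => n • P :=
  Finsupp.linearCombination_apply ℤ D

lemma pointSum_single (P : Pt W) (n : ℤ) : pointSum W (Finsupp.single P n) = n • P :=
  Finsupp.linearCombination_single ℤ n P

/-- The degree of a divisor. -/
def degree (W : WeierstrassCurve ℂ) : (Pt W →₀ ℤ) →ₗ[ℤ] ℤ :=
  Finsupp.linearCombination ℤ fun _ => 1

lemma degree_apply (D : Pt W →₀ ℤ) : degree W D = D.sum fun _ n => n := by
  rw [degree, Finsupp.linearCombination_apply]
  simp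

lemma degree_single (P : Pt W) (n : ℤ) : degree W (Finsupp.single P n) = n := by
  rw [degree, Finsupp.linearCombination_single, smul_eq_mul, mul_one]

/-! ### The coordinate ring is a Dedekind domain -/

instance : Module.Finite ℂ[X] (PolyFun W) :=
  Module.Finite.of_basis (Affine.CoordinateRing.basis W.toAffine)

instance : Ring.DimensionLEOne (PolyFun W) := Ring.DimensionLEOne.of_isIntegral ℂ[X] _

/-- The ideal of the affine point `(a, b)` in the coordinate ring. -/
def affineIdeal (W : WeierstrassCurve ℂ) (a b : ℂ) : Ideal (PolyFun W) :=
  Affine.CoordinateRing.XYIdeal W.toAffine a (C b)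

lemma affineIdeal_eq_map {a b : ℂ} (h : W.toAffine.Nonsingular a b) :
    affineIdeal W a b =
      (pointIdeal (.some a b h : Pt W)).map (Affine.CoordinateRing.mk W.toAffine) := by
  rw [pointIdeal, Ideal.map_span, Set.image_pair]
  rfl

lemma mk_mem_affineIdeal {a b : ℂ} (h : W.toAffine.Nonsingular a b) {A : ℂ[X][Y]} :
    Affine.CoordinateRing.mk W.toAffine A ∈ affineIdeal W a b ↔
      evalAt (.some a b h : Pt W) A = 0 := by
  rw [affineIdeal_eq_map h, ← mem_pointIdeal]
  refine ⟨fun hA => ?_, Ideal.mem_map_of_mem _⟩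
  obtain ⟨B, hB, hBA⟩ := (Ideal.mem_map_iff_of_surjective _ AdjoinRoot.mk_surjective).1 hA
  obtain ⟨D, hD⟩ := AdjoinRoot.mk_eq_mk.1 hBA
  -- Vanishing at the point does not depend on the representative, because the curve polynomial
  -- itself vanishes there.
  have hp : W.toAffine.polynomial ∈ pointIdeal (.some a b h : Pt W) := mem_pointIdeal.2 h.1
  rw [show A = B - W.toAffine.polynomial * D by rw [← hD]; ring]
  exact Ideal.sub_mem _ hB (Ideal.mul_mem_right _ _ hp)

lemma affineIdeal_isMaximal {a b : ℂ} (h : W.toAffine.Nonsingular a b) :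
    (affineIdeal W a b).IsMaximal := by
  rw [Ideal.isMaximal_iff]
  constructor
  · rw [← map_one (Affine.CoordinateRing.mk W.toAffine), mk_mem_affineIdeal h, evalAt_eq, map_one]
    exact one_ne_zero
  · intro J r hJ hr hrJ
    obtain ⟨A, rfl⟩ := AdjoinRoot.mk_surjective r
    rw [mk_mem_affineIdeal h] at hr
    set c := evalAt (.some a b h : Pt W) A with hc
    have h1 : Affine.CoordinateRing.mk W.toAffine (1 - C (C c⁻¹) * A) ∈ J := by
      apply hJ
      rw [mk_mem_affineIdeal h, evalAt_eq, map_sub, map_mul, map_one, ← evalAt_eq, ← evalAt_eq,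
        evalAt_CC, ← hc, inv_mul_cancel₀ hr, sub_self]
    have h2 := J.add_mem h1 (J.mul_mem_left (Affine.CoordinateRing.mk W.toAffine (C (C c⁻¹))) hrJ)
    rwa [← map_mul, ← map_add, sub_add_cancel, map_one] at h2

lemma affineIdeal_ne_bot (a b : ℂ) : affineIdeal W a b ≠ ⊥ := by
  intro h
  have : Affine.CoordinateRing.XClass W.toAffine a ∈ affineIdeal W a b :=
    Ideal.subset_span (Set.mem_insert _ _)
  rw [h, Ideal.mem_bot] at this
  exact Affine.CoordinateRing.XClass_ne_zero a this

variable [W.IsElliptic]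

/-- Nullstellensatz for the coordinate ring. -/
lemma exists_eq_affineIdeal {p : Ideal (PolyFun W)} (hp : p.IsPrime) (h0 : p ≠ ⊥) :
    ∃ a b : ℂ, W.toAffine.Nonsingular a b ∧ p = affineIdeal W a b := by
  have hmax : p.IsMaximal := hp.isMaximal h0
  let _ := Ideal.Quotient.field p
  -- By Zariski's lemma the residue field is finite over `ℂ`, hence equal to `ℂ`; the residues of
  -- `x` and `y` are the coordinates of the point.
  have hfin : Module.Finite ℂ (PolyFun W ⧸ p) := finite_of_finite_type_of_isJacobsonRing ℂ _
  have hbij := (IsAlgClosed.algebraMap_bijective_of_isIntegral (k := ℂ) (K := PolyFun W ⧸ p)).2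
  obtain ⟨a, ha⟩ := hbij (Ideal.Quotient.mk p (Affine.CoordinateRing.mk W.toAffine (C X)))
  obtain ⟨b, hb⟩ := hbij (Ideal.Quotient.mk p (Affine.CoordinateRing.mk W.toAffine Y))
  let φ : ℂ[X][Y] →ₐ[ℂ] PolyFun W ⧸ p :=
    (Ideal.Quotient.mkₐ ℂ p).comp ((AdjoinRoot.mkₐ W.toAffine.polynomial).restrictScalars ℂ)
  let ψ : ℂ[X][Y] →ₐ[ℂ] PolyFun W ⧸ p := (Algebra.ofId ℂ _).comp (aevalAeval a b)
  have hφψ : φ = ψ := by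
    apply algHom_ext_XY
    · rw [AlgHom.comp_apply _ (aevalAeval a b), aevalAeval_X]
      exact ha.symm
    · rw [AlgHom.comp_apply _ (aevalAeval a b), aevalAeval_Y]
      exact hb.symm
  have hmem (A : ℂ[X][Y]) (hA : A.evalEval a b = 0) :
      Affine.CoordinateRing.mk W.toAffine A ∈ p := by
    rw [← Ideal.Quotient.eq_zero_iff_mem]
    change φ A = 0
    rw [hφψ, AlgHom.comp_apply, coe_aevalAeval_eq_evalEval, hA, map_zero]
  have hE : W.toAffine.Equation a b := by
    have h1 : φ W.toAffine.polynomial = 0 := by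
      have : Affine.CoordinateRing.mk W.toAffine W.toAffine.polynomial = 0 := AdjoinRoot.mk_self
      change Ideal.Quotient.mk p (Affine.CoordinateRing.mk W.toAffine _) = 0
      rw [this, map_zero]
    rw [hφψ, AlgHom.comp_apply, coe_aevalAeval_eq_evalEval] at h1
    exact (map_eq_zero_iff _ (algebraMap ℂ (PolyFun W ⧸ p)).injective).1 h1
  have hns := Affine.equation_iff_nonsingular.1 hE
  refine ⟨a, b, hns, ((affineIdeal_isMaximal hns).eq_of_le hmax.ne_top ?_).symm⟩
  intro r hr
  obtain ⟨A, rfl⟩ := AdjoinRoot.mk_surjective r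
  exact hmem A ((mk_mem_affineIdeal hns).1 hr)

/-- Every nonzero prime is the ideal of a nonsingular point. The local generator of that ideal makes
the maximal ideal of the localization principal. -/
instance : IsDedekindDomainDvr (PolyFun W) where
  toIsNoetherian := inferInstance
  is_dvr_at_nonzero_prime := by
    intro p h0 hp
    obtain ⟨a, b, h, rfl⟩ := exists_eq_affineIdeal hp h0
    set p := affineIdeal W a b
    have hnf : ¬IsField (Localization.AtPrime p) :=
      IsLocalization.AtPrime.not_isField (PolyFun W) h0 _
    have : IsNoetherianRing (Localization.AtPrime p) :=
      IsLocalization.isNoetherianRing p.primeCompl _ inferInstance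
    refine ((IsDiscreteValuationRing.TFAE (Localization.AtPrime p) hnf).out 0 4).2 ?_
    rw [← Localization.AtPrime.map_eq_maximalIdeal]
    obtain ⟨π, hπ, H⟩ := exists_local_generator (.some a b h : Pt W)
    refine ⟨algebraMap _ _ (Affine.CoordinateRing.mk W.toAffine π), ?_⟩
    rw [Ideal.submodule_span_eq]
    refine le_antisymm ?_ ?_
    · rw [Ideal.map_le_iff_le_comap]
      intro r hr
      obtain ⟨A, rfl⟩ := AdjoinRoot.mk_surjective r
      obtain ⟨U, V, hU, hUV⟩ := H A (mem_pointIdeal.2 ((mk_mem_affineIdeal h).1 hr))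
      rw [toFunHom_some, toFunHom_some, toFunHom_some, toFunHom_some,
        ← map_mul (algebraMap (PolyFun W) (Fun W)), ← map_mul (algebraMap (PolyFun W) (Fun W))] at hUV
      have hUV' := congrArg (algebraMap (PolyFun W) (Localization.AtPrime p))
        (IsFractionRing.injective (PolyFun W) (Fun W) hUV)
      rw [map_mul, map_mul] at hUV'
      have hunit : IsUnit (algebraMap (PolyFun W) (Localization.AtPrime p)
          (Affine.CoordinateRing.mk W.toAffine U)) :=
        IsLocalization.map_units _ (⟨_, fun hm => hU ((mk_mem_affineIdeal h).1 hm)⟩ : p.primeCompl)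
      rw [Ideal.mem_comap, Ideal.mem_span_singleton]
      obtain ⟨u, hu⟩ := hunit
      rw [← hu] at hUV'
      refine ⟨↑u⁻¹ * algebraMap _ _ (Affine.CoordinateRing.mk W.toAffine V), ?_⟩
      rw [mul_left_comm, mul_comm (algebraMap _ _ (Affine.CoordinateRing.mk W.toAffine π)),
        ← hUV', Units.inv_mul_cancel_left]
    · rw [Ideal.span_singleton_le_iff_mem]
      exact Ideal.mem_map_of_mem _ ((mk_mem_affineIdeal h).2 (mem_pointIdeal.1 hπ))

/-- The maximal ideal of the coordinate ring at an affine point. -/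
def primeAt {a b : ℂ} (h : W.toAffine.Nonsingular a b) : HeightOneSpectrum (PolyFun W) where
  asIdeal := affineIdeal W a b
  isPrime := (affineIdeal_isMaximal h).isPrime
  ne_bot := affineIdeal_ne_bot a b

lemma isPlaceAt_primeAt {a b : ℂ} (h : W.toAffine.Nonsingular a b) :
    IsPlaceAt ((primeAt h).valuation (Fun W)) (.some a b h) where
  const_le c := by
    rw [IsScalarTower.algebraMap_apply ℂ (PolyFun W) (Fun W)]
    exact (primeAt h).valuation_le_one _
  fst_lt := by
    change (primeAt h).valuation (Fun W) (x W - algebraMap ℂ _ a) < 1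
    rw [← algebraMap_XClass, HeightOneSpectrum.valuation_lt_one_iff_mem]
    exact Ideal.subset_span (Set.mem_insert _ _)
  snd_lt := by
    change (primeAt h).valuation (Fun W) (y W - algebraMap ℂ _ b) < 1
    rw [← algebraMap_YClass, HeightOneSpectrum.valuation_lt_one_iff_mem]
    exact Ideal.subset_span (Set.mem_insert_of_mem _ rfl)
  exists_uniformizer := (primeAt h).valuation_exists_uniformizer (Fun W)

/-! ### The valuation at a point -/

/-- The valuation at a point. -/
def val : Pt W → Valuation (Fun W) (WithZero (Multiplicative ℤ))
  | .zero => valInfty W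
  | .some _ _ h => (primeAt h).valuation (Fun W)

lemma isPlaceAt_val : ∀ P : Pt W, IsPlaceAt (val P) P
  | .zero => isPlaceAt_valInfty
  | .some _ _ h => isPlaceAt_primeAt h

lemma val_zero : val (0 : Pt W) = valInfty W := rfl

lemma val_some {a b : ℂ} (h : W.toAffine.Nonsingular a b) :
    val (.some a b h : Pt W) = (primeAt h).valuation (Fun W) := rfl

/-- Every discrete valuation of the function field that is trivial on constants is centered at a
point. -/
lemma exists_isPlaceAt {v : Valuation (Fun W) (WithZero (Multiplicative ℤ))}
    (hc : ∀ c : ℂ, v (algebraMap ℂ (Fun W) c) ≤ 1) (hϖ : ∃ ϖ, v ϖ = exp (-1 : ℤ)) :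
    ∃ P : Pt W, IsPlaceAt v P := by
  have e := equation_x_y W
  have hcm (c : ℂ) (φ : Fun W) : v (algebraMap ℂ (Fun W) c * φ) ≤ v φ := by
    rw [map_mul]; exact mul_le_of_le_one_left' (hc c)
  rcases le_or_gt (v (x W)) 1 with hx | hx
  -- The equation is monic in `y`: if `v y > 1`, then `y²` would equal a sum of terms of valuation
  -- at most `v y`.
  · have hy : v (y W) ≤ 1 := by
      by_contra! hy
      have h1 : y W ^ 2 = x W ^ 3 + algebraMap ℂ _ W.a₂ * x W ^ 2 + algebraMap ℂ _ W.a₄ * x W +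
        algebraMap ℂ _ W.a₆ - algebraMap ℂ _ W.a₁ * (x W * y W) - algebraMap ℂ _ W.a₃ * y W := by
        linear_combination e
      have h2 : v (y W ^ 2) ≤ v (y W) := by
        rw [h1]
        have hpow (n : ℕ) : v (x W ^ n) ≤ v (y W) := by
          rw [map_pow]; exact (pow_le_one' hx n).trans hy.le
        refine v.map_sub_le (v.map_sub_le (v.map_add_le (v.map_add_le (v.map_add_le (hpow 3)
          ((hcm _ _).trans (hpow 2))) ((hcm _ _).trans (hx.trans hy.le)))
          ((hc _).trans hy.le)) ((hcm _ _).trans ?_)) (hcm _ _)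
        rw [map_mul]
        exact mul_le_of_le_one_left' hx
      rw [map_pow, sq] at h2
      exact h2.not_gt (lt_mul_of_one_lt_left (zero_lt_one.trans hy) hy)
    let S : Subalgebra ℂ (Fun W) := { v.integer with algebraMap_mem' := hc }
    have hS (r : PolyFun W) : v (algebraMap _ _ r) ≤ 1 := by
      obtain ⟨A, rfl⟩ := AdjoinRoot.mk_surjective r
      have := aevalAeval_mem S (a := x W) (b := y W) hx hy A
      rw [← polyHom_eq] at this
      exact this
    -- Now `v ≤ 1` on `ℂ[E]`, and the centre of `v` is a prime ideal. It is nonzero because it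
    -- contains the numerator of a uniformizer, so it is the ideal of a point.
    let p : Ideal (PolyFun W) :=
      { carrier := {r | v (algebraMap _ _ r) < 1}
        zero_mem' := by simp
        add_mem' := fun {r s} hr hs => by
          rw [Set.mem_ofPred_eq, map_add]
          exact v.map_add_lt hr hs
        smul_mem' := fun r s hs => by
          rw [Set.mem_ofPred_eq, smul_eq_mul, map_mul, map_mul]
          exact (mul_le_of_le_one_left' (hS r)).trans_lt hs }
    have hmem (r : PolyFun W) : r ∈ p ↔ v (algebraMap _ _ r) < 1 := Iff.rfl
    have hp : p.IsPrime := by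
      refine ⟨?_, ?_⟩
      · rw [Ideal.ne_top_iff_one, hmem, map_one, map_one]
        exact lt_irrefl _
      · intro r s hrs
        by_contra! h
        rw [hmem, map_mul, map_mul, (hS r).antisymm (not_lt.1 h.1),
          (hS s).antisymm (not_lt.1 h.2), mul_one] at hrs
        exact lt_irrefl _ hrs
    have h0 : p ≠ ⊥ := by
      obtain ⟨ϖ, hϖ⟩ := hϖ
      obtain ⟨r, s, hs, rfl⟩ := exists_eq_div ϖ
      have hs' : v (algebraMap _ _ s) ≠ 0 := v.ne_zero_iff.2 (algebraMap_polyFun_ne_zero hs)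
      rw [map_div₀, div_eq_iff hs'] at hϖ
      have hr : r ∈ p := by
        rw [hmem, hϖ]
        exact (mul_le_of_le_one_right' (hS s)).trans_lt exp_neg_one_lt
      intro hbot
      rw [hbot, Ideal.mem_bot] at hr
      rw [hr, map_zero, map_zero] at hϖ
      exact mul_ne_zero exp_ne_zero hs' hϖ.symm
    obtain ⟨a, b, h, hab⟩ := exists_eq_affineIdeal hp h0
    refine ⟨.some a b h, hc, ?_, ?_, hϖ⟩
    · have : Affine.CoordinateRing.XClass W.toAffine a ∈ p := by
        rw [hab]; exact Ideal.subset_span (Set.mem_insert _ _)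
      rwa [hmem, algebraMap_XClass] at this
    · have : Affine.CoordinateRing.YClass W.toAffine (C b) ∈ p := by
        rw [hab]; exact Ideal.subset_span (Set.mem_insert_of_mem _ rfl)
      rwa [hmem, algebraMap_YClass] at this
  -- If `v y ≤ v x`, all terms of the equation other than `x³` have valuation at most `(v x)²`,
  -- which is less than `(v x)³`. So `x / y` and `1 / y` vanish, and the centre is `O`.
  · have hxy : v (x W) < v (y W) := by
      by_contra! hy
      have h1 : x W ^ 3 = y W ^ 2 + algebraMap ℂ _ W.a₁ * (x W * y W) + algebraMap ℂ _ W.a₃ * y W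
        - algebraMap ℂ _ W.a₂ * x W ^ 2 - algebraMap ℂ _ W.a₄ * x W - algebraMap ℂ _ W.a₆ := by
        linear_combination -e
      have hx2 : v (x W) ≤ v (x W) ^ 2 := by
        rw [sq]; exact le_mul_of_one_le_left' hx.le
      have h2 : v (x W ^ 3) ≤ v (x W) ^ 2 := by
        rw [h1]
        refine v.map_sub_le (v.map_sub_le (v.map_sub_le (v.map_add_le (v.map_add_le ?_
          ((hcm _ _).trans ?_)) ((hcm _ _).trans (hy.trans hx2))) ((hcm _ _).trans ?_))
          ((hcm _ _).trans hx2)) ((hc _).trans (hx.le.trans hx2))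
        · rw [map_pow]; exact pow_le_pow_left' hy 2
        · rw [map_mul, sq]; exact mul_le_mul_right hy _
        · rw [map_pow]
      rw [map_pow] at h2
      exact h2.not_gt (pow_lt_pow_right₀ hx (by norm_num))
    have hy0 : 0 < v (y W) := zero_lt_one.trans (hx.trans hxy)
    refine ⟨0, hc, ?_, ?_, hϖ⟩
    · change v (x W / y W - algebraMap ℂ _ 0) < 1
      rw [map_zero, sub_zero, map_div₀, div_lt_one₀ hy0]
      exact hxy
    · change v (1 / y W - algebraMap ℂ _ 0) < 1
      rw [map_zero, sub_zero, map_div₀, map_one, div_lt_one₀ hy0]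
      exact hx.trans hxy

lemma IsPlaceAt.eq_val {v : Valuation (Fun W) (WithZero (Multiplicative ℤ))} {P : Pt W}
    (hv : IsPlaceAt v P) : v = val P := hv.eq (isPlaceAt_val P)

end ToroidalBelyi
end

open WeierstrassCurve

noncomputable section

namespace ToroidalBelyi

open WithZero IsDedekindDomain nonZeroDivisors

variable {W : WeierstrassCurve ℂ} [W.IsElliptic]

/-! ### Divisors -/

lemma count_spanSingleton (p : HeightOneSpectrum (PolyFun W)) {φ : Fun W} (hφ : φ ≠ 0) :
    FractionalIdeal.count (Fun W) p (FractionalIdeal.spanSingleton (PolyFun W)⁰ φ) =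
      -log (p.valuation (Fun W) φ) := by
  classical
  have key {r : PolyFun W} (hr : r ≠ 0) : FractionalIdeal.count (Fun W) p
      (FractionalIdeal.spanSingleton (PolyFun W)⁰ (algebraMap _ (Fun W) r)) =
      -log (p.valuation (Fun W) (algebraMap _ (Fun W) r)) := by
    rw [← FractionalIdeal.coeIdeal_span_singleton, FractionalIdeal.count_coe,
      HeightOneSpectrum.valuation_of_algebraMap, p.intValuation_if_neg hr, log_exp, neg_neg]
    · rw [Ne, Ideal.zero_eq_bot, Ideal.span_singleton_eq_bot]
      exact hr
  obtain ⟨r, s, hs, rfl⟩ := exists_eq_div φ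
  have hs' := algebraMap_polyFun_ne_zero hs
  have hr' : algebraMap _ (Fun W) r ≠ 0 := fun h => hφ (by rw [h, zero_div])
  have hr : r ≠ 0 := fun h => hr' (by rw [h, map_zero])
  rw [div_eq_mul_inv, ← FractionalIdeal.spanSingleton_mul_spanSingleton,
    FractionalIdeal.count_mul, ← FractionalIdeal.spanSingleton_inv, FractionalIdeal.count_inv,
    key hr, key hs, map_mul, map_inv₀, log_mul, log_inv, neg_add]
  · exact ((p.valuation (Fun W)).ne_zero_iff).2 hr'
  · exact inv_ne_zero (((p.valuation (Fun W)).ne_zero_iff).2 hs')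
  · exact FractionalIdeal.spanSingleton_ne_zero_iff.2 hr'
  · exact FractionalIdeal.spanSingleton_ne_zero_iff.2 (inv_ne_zero hs')

lemma exists_eq_primeAt (p : HeightOneSpectrum (PolyFun W)) :
    ∃ (a b : ℂ) (h : W.toAffine.Nonsingular a b), p = primeAt h := by
  obtain ⟨a, b, h, hab⟩ := exists_eq_affineIdeal p.isPrime p.ne_bot
  exact ⟨a, b, h, HeightOneSpectrum.ext hab⟩

lemma primeAt_injective {a b a' b' : ℂ} {h : W.toAffine.Nonsingular a b}
    {h' : W.toAffine.Nonsingular a' b'} (e : primeAt h = primeAt h') :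
    (.some a b h : Pt W) = .some a' b' h' :=
  (isPlaceAt_primeAt h).point_eq (e ▸ isPlaceAt_primeAt h')

/-- Only finitely many primes occur in the factorization of the fractional ideal of `φ`; `O` adds at
most one more point. -/
lemma finite_support_log_val (φ : Fun W) : (Function.support fun P => -log (val P φ)).Finite := by
  by_cases hφ : φ = 0
  · simp [hφ]
  choose a b h hp using exists_eq_primeAt (W := W)
  have hfin := FractionalIdeal.finite_factors (FractionalIdeal.spanSingleton (PolyFun W)⁰ φ)
  rw [Filter.eventually_cofinite] at hfin
  refine ((hfin.image fun p => (.some (a p) (b p) (h p) : Pt W)).insert 0).subset ?_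
  rintro (_ | ⟨a', b', h'⟩) hP
  · exact Set.mem_insert _ _
  · refine Set.mem_insert_of_mem _ ⟨primeAt h', ?_, (primeAt_injective (hp _)).symm⟩
    rw [Set.mem_ofPred_eq, count_spanSingleton _ hφ]
    exact hP

/-- The divisor of a function. -/
def divisor (φ : Fun W) : Pt W →₀ ℤ :=
  Finsupp.ofSupportFinite (fun P => -log (val P φ)) (finite_support_log_val φ)

lemma divisor_apply (φ : Fun W) (P : Pt W) : divisor φ P = -log (val P φ) := rfl

lemma ord_eq_divisor (φ : Fun W) (P : Pt W) : ord P φ = divisor φ P := (isPlaceAt_val P).ord_eq φ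

lemma val_eq_exp {φ : Fun W} (hφ : φ ≠ 0) (P : Pt W) : val P φ = exp (-divisor φ P) := by
  rw [divisor_apply, neg_neg, exp_log ((val P).ne_zero_iff.2 hφ)]

lemma divisor_mul {φ ψ : Fun W} (hφ : φ ≠ 0) (hψ : ψ ≠ 0) :
    divisor (φ * ψ) = divisor φ + divisor ψ := by
  ext P
  rw [Finsupp.add_apply, divisor_apply, divisor_apply, divisor_apply, map_mul,
    log_mul ((val P).ne_zero_iff.2 hφ) ((val P).ne_zero_iff.2 hψ), neg_add]

lemma divisor_inv (φ : Fun W) : divisor φ⁻¹ = -divisor φ := by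
  ext P
  rw [Finsupp.neg_apply, divisor_apply, divisor_apply, map_inv₀, log_inv]

/-- The fractional ideal of a point. -/
def pointUnit : Pt W → (FractionalIdeal (PolyFun W)⁰ (Fun W))ˣ
  | .zero => 1
  | .some _ _ h => Affine.CoordinateRing.XYIdeal' (W := W.toAffine) h

lemma mk_pointUnit : ∀ P : Pt W,
    ClassGroup.mk (Fun W) (pointUnit P) = (Affine.Point.toClass P).toMul
  | .zero => map_one _
  | .some _ _ _ => rfl

lemma pointUnit_some {a b : ℂ} (h : W.toAffine.Nonsingular a b) :
    (pointUnit (.some a b h : Pt W) : FractionalIdeal (PolyFun W)⁰ (Fun W)) =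
      (primeAt h).asIdeal := rfl

/-- The fractional ideal of the affine part of a divisor. -/
def divisorUnit (D : Pt W →₀ ℤ) : (FractionalIdeal (PolyFun W)⁰ (Fun W))ˣ :=
  D.prod fun P n => pointUnit P ^ n

/-- `Affine.Point.toClass` is a group homomorphism, so the class of a product of point ideals is the
image of the sum of the points. As it is injective, the ideal is principal exactly when that sum is
zero. -/
lemma mk_divisorUnit (D : Pt W →₀ ℤ) : ClassGroup.mk (Fun W) (divisorUnit D) =
    (Affine.Point.toClass (D.sum fun P n => n • P)).toMul := by
  rw [divisorUnit, map_finsuppProd, map_finsuppSum]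
  simp_rw [map_zpow, mk_pointUnit, map_zsmul]
  rfl

lemma divisorUnit_add (D D' : Pt W →₀ ℤ) :
    divisorUnit (D + D') = divisorUnit D * divisorUnit D' :=
  Finsupp.prod_add_index' (fun _ => zpow_zero _) fun _ => zpow_add _

/-- The multiplicity of a prime in an invertible fractional ideal. -/
def countHom (p : HeightOneSpectrum (PolyFun W)) :
    (FractionalIdeal (PolyFun W)⁰ (Fun W))ˣ →* Multiplicative ℤ :=
  MonoidHom.mk' (fun I => Multiplicative.ofAdd (FractionalIdeal.count (Fun W) p I)) fun I J => by
    rw [Units.val_mul, FractionalIdeal.count_mul _ _ I.ne_zero J.ne_zero, ofAdd_add]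

lemma countHom_apply (p : HeightOneSpectrum (PolyFun W))
    (I : (FractionalIdeal (PolyFun W)⁰ (Fun W))ˣ) :
    countHom p I = Multiplicative.ofAdd (FractionalIdeal.count (Fun W) p I) := rfl

open Classical in
lemma count_divisorUnit (D : Pt W →₀ ℤ) {a b : ℂ} (h : W.toAffine.Nonsingular a b) :
    FractionalIdeal.count (Fun W) (primeAt h) (divisorUnit D) = D (.some a b h) := by
  have hpt (P : Pt W) : FractionalIdeal.count (Fun W) (primeAt h) (pointUnit P) =
      if P = .some a b h then 1 else 0 := by
    match P with
    | .zero => exact FractionalIdeal.count_one (Fun W) (primeAt h)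
    | .some a' b' h' =>
      rw [pointUnit_some, FractionalIdeal.count_maximal]
      refine if_congr ⟨primeAt_injective, fun e => ?_⟩ rfl rfl
      cases e
      rfl
  change (countHom (primeAt h) (divisorUnit D)).toAdd = _
  rw [divisorUnit, Finsupp.prod, map_prod, toAdd_prod]
  have hterm (P : Pt W) : (countHom (primeAt h) (pointUnit P ^ D P)).toAdd =
      if P = .some a b h then D P else 0 := by
    rw [map_zpow, toAdd_zpow, countHom_apply, toAdd_ofAdd, hpt, smul_ite, smul_zero, smul_eq_mul,
      mul_one]
  rw [Finset.sum_congr rfl fun P _ => hterm P, Finset.sum_ite_eq', ite_eq_left_iff,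
    Finsupp.notMem_support_iff]
  exact Eq.symm

lemma fractionalIdeal_ext {I J : FractionalIdeal (PolyFun W)⁰ (Fun W)} (hI : I ≠ 0) (hJ : J ≠ 0)
    (h : ∀ p : HeightOneSpectrum (PolyFun W), FractionalIdeal.count (Fun W) p I =
      FractionalIdeal.count (Fun W) p J) : I = J := by
  rw [← FractionalIdeal.finprod_heightOneSpectrum_factorization' (Fun W) hI,
    ← FractionalIdeal.finprod_heightOneSpectrum_factorization' (Fun W) hJ]
  exact finprod_congr fun p => by rw [h]

/-- A fractional ideal is determined by its multiplicities at the primes, which are the affine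
points. The ideal does not see `O`, hence the restriction to `P ≠ 0`. -/
lemma spanSingleton_eq_divisorUnit_iff {φ : Fun W} (hφ : φ ≠ 0) (D : Pt W →₀ ℤ) :
    FractionalIdeal.spanSingleton (PolyFun W)⁰ φ = divisorUnit D ↔
      ∀ P : Pt W, P ≠ 0 → divisor φ P = D P := by
  have hc {a b : ℂ} (h : W.toAffine.Nonsingular a b) :
      FractionalIdeal.count (Fun W) (primeAt h) (FractionalIdeal.spanSingleton (PolyFun W)⁰ φ) =
        divisor φ (.some a b h) := count_spanSingleton _ hφ
  constructor
  · intro e P hP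
    match P with
    | .zero => exact absurd rfl hP
    | .some a b h => rw [← hc, e, count_divisorUnit]
  · intro e
    refine fractionalIdeal_ext (FractionalIdeal.spanSingleton_ne_zero_iff.2 hφ)
      (Units.ne_zero _) fun p => ?_
    obtain ⟨a, b, h, rfl⟩ := exists_eq_primeAt p
    rw [hc, count_divisorUnit, e _ (Affine.Point.some_ne_zero h)]

lemma exists_spanSingleton_eq_iff (I : (FractionalIdeal (PolyFun W)⁰ (Fun W))ˣ) :
    ClassGroup.mk (Fun W) I = 1 ↔
      ∃ φ : Fun W, φ ≠ 0 ∧ FractionalIdeal.spanSingleton (PolyFun W)⁰ φ = I := by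
  rw [ClassGroup.mk_eq_one_iff, FractionalIdeal.isPrincipal_iff]
  constructor
  · rintro ⟨φ, hφ⟩
    refine ⟨φ, ?_, hφ.symm⟩
    rintro rfl
    rw [FractionalIdeal.spanSingleton_zero] at hφ
    exact I.ne_zero hφ
  · rintro ⟨φ, -, hφ⟩
    exact ⟨φ, hφ.symm⟩

/-- The points of a principal divisor sum to zero. -/
lemma sum_divisor_smul {φ : Fun W} (hφ : φ ≠ 0) : ((divisor φ).sum fun P n => n • P) = 0 := by
  rw [← Affine.Point.toClass_eq_zero, ← toMul_eq_one, ← mk_divisorUnit,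
    exists_spanSingleton_eq_iff]
  exact ⟨φ, hφ, (spanSingleton_eq_divisorUnit_iff hφ _).2 fun _ _ => rfl⟩

/-! ### The degree of a principal divisor -/

/-- The norm lies in the contraction of the ideal, whose elements vanish at `a`, so `X - a` divides
its generator. The same holds for the opposite point. The two ideals multiply to `(x - a)`, of norm
`(X - a)²`, which leaves degree exactly `1` for each. -/
lemma exists_relNorm_affineIdeal {a b : ℂ} (h : W.toAffine.Nonsingular a b) :
    ∃ g : ℂ[X], g.natDegree = 1 ∧ Ideal.relNorm ℂ[X] (affineIdeal W a b) = Ideal.span {g} := by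
  have key {a b : ℂ} (h : W.toAffine.Nonsingular a b) :
      ∃ g : ℂ[X], Ideal.relNorm ℂ[X] (affineIdeal W a b) = Ideal.span {(X - C a) * g} := by
    obtain ⟨f, hf⟩ := IsPrincipalIdealRing.principal (Ideal.relNorm ℂ[X] (affineIdeal W a b))
    have hmem : f ∈ Ideal.relNorm ℂ[X] (affineIdeal W a b) := by
      rw [hf]; exact Submodule.mem_span_singleton_self f
    have hm : Affine.CoordinateRing.mk W.toAffine (C f) ∈ affineIdeal W a b :=
      Ideal.mem_comap.1 (Ideal.relNorm_le_comap (R := ℂ[X]) (affineIdeal W a b) hmem)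
    rw [mk_mem_affineIdeal h] at hm
    have hroot : f.IsRoot a := by
      rw [IsRoot.def, ← hm]
      exact (evalEval_C a b f).symm
    obtain ⟨g, rfl⟩ := dvd_iff_isRoot.2 hroot
    exact ⟨g, hf⟩
  obtain ⟨g, hg⟩ := key h
  obtain ⟨g', hg'⟩ := key ((Affine.nonsingular_neg _ _).2 h)
  have hmul := congrArg (Ideal.relNorm ℂ[X]) (Affine.CoordinateRing.XYIdeal_neg_mul h)
  rw [map_mul, Affine.CoordinateRing.XIdeal, Ideal.relNorm_singleton, Algebra.intNorm_eq_norm,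
    norm_XClass] at hmul
  change Ideal.relNorm ℂ[X] (affineIdeal W a _) * Ideal.relNorm ℂ[X] (affineIdeal W a b) = _ at hmul
  rw [hg, hg', Ideal.span_singleton_mul_span_singleton, Ideal.span_singleton_eq_span_singleton]
    at hmul
  have hne : (X - C a : ℂ[X]) ≠ 0 := X_sub_C_ne_zero a
  have hdeg := natDegree_eq_of_degree_eq (degree_eq_degree_of_associated hmul)
  have hne' := hmul.ne_zero_iff.2 (pow_ne_zero 2 hne)
  obtain ⟨⟨-, h1⟩, -, h2⟩ := (mul_ne_zero_iff.1 hne').imp mul_ne_zero_iff.1 mul_ne_zero_iff.1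
  rw [natDegree_mul (mul_ne_zero hne h1) (mul_ne_zero hne h2), natDegree_mul hne h1,
    natDegree_mul hne h2, natDegree_pow, natDegree_X_sub_C] at hdeg
  refine ⟨_, ?_, hg⟩
  rw [natDegree_mul hne h2, natDegree_X_sub_C]
  omega

/-- By induction over prime factors, the number of affine zeros with multiplicity is the degree of
the norm. For a principal ideal this is also the pole order at `O`. -/
lemma exists_divisor_relNorm (I : Ideal (PolyFun W)) : I ≠ 0 →
    ∃ (D : Pt W →₀ ℤ) (g : ℂ[X]), D 0 = 0 ∧
      (I : FractionalIdeal (PolyFun W)⁰ (Fun W)) = divisorUnit D ∧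
      Ideal.relNorm ℂ[X] I = Ideal.span {g} ∧ (g.natDegree : ℤ) = D.sum fun _ n => n := by
  induction I using UniqueFactorizationMonoid.induction_on_prime with
  | h₁ => exact fun h => absurd rfl h
  | h₂ I hI =>
    intro _
    rw [Ideal.isUnit_iff] at hI
    refine ⟨0, 1, rfl, ?_, ?_, ?_⟩
    · rw [hI, FractionalIdeal.coeIdeal_top]
      rfl
    · rw [hI, Ideal.relNorm_top, Ideal.span_singleton_one]
    · simp
  | h₃ J p hJ hp ih =>
    intro _
    obtain ⟨D, g, hD0, hD, hg, hdeg⟩ := ih hJ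
    obtain ⟨a, b, h, rfl⟩ := exists_eq_affineIdeal (Ideal.isPrime_of_prime hp) hp.ne_zero
    obtain ⟨f, hf, hf'⟩ := exists_relNorm_affineIdeal h
    have hg0 : g ≠ 0 := by
      rintro rfl
      rw [Ideal.span_singleton_eq_bot.2 rfl, Ideal.relNorm_eq_bot_iff] at hg
      exact hJ hg
    have hf0 : f ≠ 0 := by
      rintro rfl
      simp at hf
    refine ⟨Finsupp.single (.some a b h) 1 + D, f * g, ?_, ?_, ?_, ?_⟩
    · rw [Finsupp.add_apply, hD0, Finsupp.single_eq_of_ne (Affine.Point.some_ne_zero h).symm,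
        add_zero]
    · rw [FractionalIdeal.coeIdeal_mul, divisorUnit_add, Units.val_mul, hD]
      congr 1
      rw [divisorUnit, Finsupp.prod_single_index (zpow_zero _), zpow_one]
      rfl
    · rw [map_mul, hf', hg, Ideal.span_singleton_mul_span_singleton]
    · rw [natDegree_mul hf0 hg0, hf, Finsupp.sum_add_index' (fun _ => rfl) fun _ _ _ => rfl,
        Finsupp.sum_single_index rfl, ← hdeg]
      push_cast
      rfl

/-- A principal divisor has degree zero. -/
lemma sum_divisor {φ : Fun W} (hφ : φ ≠ 0) : ((divisor φ).sum fun _ n => n) = 0 := by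
  have key {r : PolyFun W} (hr : r ≠ 0) :
      ((divisor (algebraMap _ (Fun W) r)).sum fun _ n => n) = 0 := by
    have hr' := algebraMap_polyFun_ne_zero hr
    have hI : Ideal.span {r} ≠ 0 := by
      rwa [Ne, Ideal.zero_eq_bot, Ideal.span_singleton_eq_bot]
    obtain ⟨D, g, hD0, hD, hg, hdeg⟩ := exists_divisor_relNorm _ hI
    rw [FractionalIdeal.coeIdeal_span_singleton, spanSingleton_eq_divisorUnit_iff hr'] at hD
    rw [Ideal.relNorm_singleton, Algebra.intNorm_eq_norm,
      Ideal.span_singleton_eq_span_singleton] at hg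
    have hinf : divisor (algebraMap _ (Fun W) r) 0 = -(g.natDegree : ℤ) := by
      rw [divisor_apply, val_zero, valInfty_algebraMap hr, log_exp,
        natDegree_eq_of_degree_eq (degree_eq_degree_of_associated hg)]
    have : divisor (algebraMap _ (Fun W) r) = D + Finsupp.single 0 (-(g.natDegree : ℤ)) := by
      ext P
      by_cases hP : P = 0
      · rw [hP, Finsupp.add_apply, Finsupp.single_eq_same, hD0, zero_add, hinf]
      · rw [Finsupp.add_apply, Finsupp.single_eq_of_ne hP, add_zero, hD P hP]
    rw [this, Finsupp.sum_add_index' (fun _ => rfl) fun _ _ _ => rfl, Finsupp.sum_single_index rfl,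
      ← hdeg, add_neg_cancel]
  obtain ⟨r, s, hs, rfl⟩ := exists_eq_div φ
  have hs' := algebraMap_polyFun_ne_zero hs
  have hr' : algebraMap _ (Fun W) r ≠ 0 := fun h => hφ (by rw [h, zero_div])
  have hr : r ≠ 0 := fun h => hr' (by rw [h, map_zero])
  have h := divisor_mul hφ hs'
  rw [div_mul_cancel₀ _ hs'] at h
  have h' := congrArg (fun D : Pt W →₀ ℤ => D.sum fun _ n => n) h
  rwa [Finsupp.sum_add_index' (fun _ => rfl) fun _ _ _ => rfl, key hr, key hs, add_zero,
    eq_comm] at h'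

/-- A divisor of degree zero whose points sum to zero is principal. -/
lemma exists_divisor_eq {D : Pt W →₀ ℤ} (h0 : (D.sum fun _ n => n) = 0)
    (h1 : (D.sum fun P n => n • P) = 0) : ∃ φ : Fun W, φ ≠ 0 ∧ divisor φ = D := by
  rw [← Affine.Point.toClass_eq_zero, ← toMul_eq_one, ← mk_divisorUnit,
    exists_spanSingleton_eq_iff] at h1
  obtain ⟨φ, hφ, hD⟩ := h1
  rw [spanSingleton_eq_divisorUnit_iff hφ] at hD
  refine ⟨φ, hφ, ?_⟩
  -- The ideal fixes the divisor away from `O`; degree zero then fixes the coefficient at `O`.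
  have hE : divisor φ = D + Finsupp.single 0 (divisor φ 0 - D 0) := by
    ext P
    by_cases hP : P = 0
    · rw [hP, Finsupp.add_apply, Finsupp.single_eq_same, add_sub_cancel]
    · rw [Finsupp.add_apply, Finsupp.single_eq_of_ne hP, add_zero, hD P hP]
  have hs := sum_divisor hφ
  rw [hE, Finsupp.sum_add_index' (fun _ => rfl) fun _ _ _ => rfl, Finsupp.sum_single_index rfl,
    h0, zero_add] at hs
  rw [hE, hs, Finsupp.single_zero, add_zero]

/-- A function without poles at affine points is a polynomial function. -/
lemma exists_polyFun_eq {φ : Fun W} (h : ∀ P : Pt W, P ≠ 0 → 0 ≤ divisor φ P) :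
    ∃ r : PolyFun W, algebraMap _ (Fun W) r = φ := by
  by_cases hφ : φ = 0
  · exact ⟨0, by rw [hφ, map_zero]⟩
  obtain ⟨r, hr⟩ := HeightOneSpectrum.mem_integers_of_valuation_le_one (R := PolyFun W) (Fun W) φ
    fun p => by
      obtain ⟨a, b, hab, rfl⟩ := exists_eq_primeAt p
      have := h (.some a b hab) (Affine.Point.some_ne_zero hab)
      rw [← val_some, val_eq_exp hφ, ← exp_zero, exp_le_exp]
      omega
  exact ⟨r, hr⟩

/-- A function without poles is constant. -/
lemma exists_const_eq {φ : Fun W} (h : ∀ P : Pt W, 0 ≤ divisor φ P) :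
    ∃ c : ℂ, algebraMap ℂ (Fun W) c = φ := by
  have hle (P : Pt W) (φ : Fun W) (h : 0 ≤ divisor φ P) : val P φ ≤ 1 := by
    by_cases hφ : φ = 0
    · simp [hφ]
    · rw [val_eq_exp hφ, ← exp_zero, exp_le_exp]
      omega
  have hv : value φ 0 ≠ OnePoint.infty := fun hv =>
    ((isPlaceAt_val 0).value_eq_infty_iff.1 hv).not_ge (hle _ _ (h 0))
  obtain ⟨c, hc⟩ := OnePoint.ne_infty_iff_exists.1 hv
  refine ⟨c, ?_⟩
  by_contra hne
  -- Were it nonzero, `φ - φ(O)` would have a zero at `O` and no poles, so its divisor would have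
  -- positive degree.
  have hφ : φ - algebraMap ℂ _ c ≠ 0 := sub_ne_zero.2 (Ne.symm hne)
  have hlt := (isPlaceAt_val 0).value_eq_some_iff.1 hc.symm
  have hnn (P : Pt W) : 0 ≤ divisor (φ - algebraMap ℂ _ c) P := by
    have := (val P).map_sub_le (hle _ _ (h P)) ((isPlaceAt_val P).const_le c)
    rw [val_eq_exp hφ, ← exp_zero, exp_le_exp] at this
    omega
  rw [val_eq_exp hφ, ← exp_zero, exp_lt_exp] at hlt
  have hsum := sum_divisor hφ
  rw [Finsupp.sum, Finset.sum_eq_zero_iff_of_nonneg fun P _ => hnn P] at hsum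
  have := hsum 0 (Finsupp.mem_support_iff.2 (by omega))
  omega

end ToroidalBelyi
end

open WeierstrassCurve

noncomputable section

namespace ToroidalBelyi

open WithZero IsDedekindDomain Filter

variable {W : WeierstrassCurve ℂ}

/-! ### Points over the function field -/

instance : DecidableEq (Fun W) := Classical.decEq _

/-- The group of points of `E` over the function field. -/
abbrev FunPt (W : WeierstrassCurve ℂ) : Type := (Affine.baseChange W.toAffine (Fun W)).Point

/-- A complex point as a point over the function field. -/
def constPt : Pt W → FunPt W
  | .zero => .zero
  | .some a b h => .some (algebraMap ℂ (Fun W) a) (algebraMap ℂ (Fun W) b)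
      (constPt_nonsingular h)

lemma constPt_neg : ∀ P : Pt W, constPt (-P) = -constPt P
  | .zero => rfl
  | .some a b h => by
    rw [Affine.Point.neg_some, constPt, constPt, Affine.Point.neg_some, Affine.Point.some.injEq]
    refine ⟨rfl, ?_⟩
    simp [Affine.negY]

lemma map_constPt (σ : Fun W →ₐ[ℂ] Fun W) : ∀ P : Pt W,
    Affine.Point.map (W' := W.toAffine) σ (constPt P) = constPt P
  | .zero => rfl
  | .some a b h => by
    rw [constPt, Affine.Point.map_some, Affine.Point.some.injEq]
    exact ⟨σ.commutes a, σ.commutes b⟩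

variable [W.IsElliptic]

/-! ### Values of functions at points -/

/-- The function `φ` is regular at `P`, with value `c`. -/
def HasValue (P : Pt W) (φ : Fun W) (c : ℂ) : Prop := val P (φ - algebraMap ℂ (Fun W) c) < 1

namespace HasValue

variable {P : Pt W} {φ ψ : Fun W} {c d : ℂ}

lemma iff_value : HasValue P φ c ↔ value φ P = OnePoint.some c :=
  (isPlaceAt_val P).value_eq_some_iff.symm

lemma unique (hc : HasValue P φ c) (hd : HasValue P φ d) : c = d :=
  (OnePoint.some_eq_iff _ _).1 ((iff_value.1 hc).symm.trans (iff_value.1 hd))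

lemma val_le (hc : HasValue P φ c) : val P φ ≤ 1 := by
  have := (val P).map_add_le hc.le ((isPlaceAt_val P).const_le c)
  rwa [sub_add_cancel] at this

lemma const (P : Pt W) (c : ℂ) : HasValue P (algebraMap ℂ (Fun W) c) c := by
  rw [HasValue, sub_self, map_zero]
  exact zero_lt_one

lemma add (h₁ : HasValue P φ c) (h₂ : HasValue P ψ d) : HasValue P (φ + ψ) (c + d) := by
  rw [HasValue, map_add, add_sub_add_comm]
  exact (val P).map_add_lt h₁ h₂

lemma neg (h : HasValue P φ c) : HasValue P (-φ) (-c) := by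
  rw [HasValue, map_neg, ← neg_sub', Valuation.map_neg]
  exact h

lemma sub (h₁ : HasValue P φ c) (h₂ : HasValue P ψ d) : HasValue P (φ - ψ) (c - d) := by
  rw [sub_eq_add_neg, sub_eq_add_neg]
  exact h₁.add h₂.neg

lemma mul (h₁ : HasValue P φ c) (h₂ : HasValue P ψ d) : HasValue P (φ * ψ) (c * d) := by
  have e : φ * ψ - algebraMap ℂ (Fun W) (c * d) =
      φ * (ψ - algebraMap ℂ _ d) + algebraMap ℂ _ d * (φ - algebraMap ℂ _ c) := by
    rw [map_mul]; ring
  rw [HasValue, e]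
  refine (val P).map_add_lt ?_ ?_
  · rw [map_mul]
    exact (mul_le_of_le_one_left' h₁.val_le).trans_lt h₂
  · rw [map_mul]
    exact (mul_le_of_le_one_left' ((isPlaceAt_val P).const_le d)).trans_lt h₁

lemma pow (h : HasValue P φ c) (n : ℕ) : HasValue P (φ ^ n) (c ^ n) := by
  induction n with
  | zero => simpa using const P 1
  | succ n ih => rw [pow_succ, pow_succ]; exact ih.mul h

lemma val_eq_one (h : HasValue P φ c) (hc : c ≠ 0) : val P φ = 1 := by
  have h1 := (isPlaceAt_val P).const_eq hc
  rw [← h1]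
  exact (val P).map_eq_of_sub_lt (by rwa [h1])

lemma inv (h : HasValue P φ c) (hc : c ≠ 0) : HasValue P φ⁻¹ c⁻¹ := by
  have h0 : φ ≠ 0 := by
    rintro rfl
    exact zero_ne_one (((val P).map_zero).symm.trans (h.val_eq_one hc))
  have hc' : algebraMap ℂ (Fun W) c ≠ 0 := (_root_.map_ne_zero _).2 hc
  have e : φ⁻¹ - algebraMap ℂ (Fun W) c⁻¹ = -(φ - algebraMap ℂ _ c) / (φ * algebraMap ℂ _ c) := by
    rw [map_inv₀]
    field_simp
    ring
  rw [HasValue, e, map_div₀, map_mul, h.val_eq_one hc, (isPlaceAt_val P).const_eq hc, mul_one,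
    div_one, Valuation.map_neg]
  exact h

lemma div (h₁ : HasValue P φ c) (h₂ : HasValue P ψ d) (hd : d ≠ 0) :
    HasValue P (φ / ψ) (c / d) := by
  rw [div_eq_mul_inv, div_eq_mul_inv]
  exact h₁.mul (h₂.inv hd)

end HasValue

lemma finite_hasValue_zero {φ : Fun W} (hφ : φ ≠ 0) : {P : Pt W | HasValue P φ 0}.Finite := by
  refine (divisor φ).hasFiniteSupport.subset fun P hP => ?_
  have h : val P (φ - algebraMap ℂ (Fun W) 0) < 1 := hP
  rw [map_zero, sub_zero, val_eq_exp hφ, ← exp_zero, exp_lt_exp] at h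
  rw [Function.mem_support]
  omega

lemma eventually_not_hasValue_zero {φ : Fun W} (hφ : φ ≠ 0) :
    ∀ᶠ P : Pt W in cofinite, ¬HasValue P φ 0 := by
  rw [eventually_cofinite]
  simpa using finite_hasValue_zero hφ

/-- If `φ - c` had no zero, its inverse would have no pole and would be constant. -/
lemma exists_hasValue {φ : Fun W} (hφ : φ ∉ Set.range (algebraMap ℂ (Fun W))) (c : ℂ) :
    ∃ P : Pt W, HasValue P φ c := by
  by_contra! h
  have h0 : φ - algebraMap ℂ _ c ≠ 0 := fun h0 => hφ ⟨c, (sub_eq_zero.1 h0).symm⟩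
  obtain ⟨d, hd⟩ := exists_const_eq (φ := (φ - algebraMap ℂ _ c)⁻¹) fun P => by
    have hP := h P
    rw [HasValue, val_eq_exp h0, ← exp_zero, exp_lt_exp] at hP
    rw [divisor_inv, Finsupp.neg_apply]
    omega
  exact hφ ⟨d⁻¹ + c, by rw [map_add, map_inv₀, hd, inv_inv, sub_add_cancel]⟩

/-- The function `x` takes every complex value. -/
instance : Infinite (Pt W) := by
  choose P hP using exists_hasValue (x_notMem_range (W := W))
  refine Infinite.of_injective P fun c d h => (hP c).unique ?_
  rw [h]
  exact hP d

/-! ### The generic point -/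

lemma generic_nonsingular :
    (Affine.baseChange W.toAffine (Fun W)).Nonsingular (x W) (y W) := by
  have : ((Affine.baseChange W.toAffine (Fun W)) : WeierstrassCurve (Fun W)).IsElliptic :=
    inferInstanceAs (WeierstrassCurve.map W (algebraMap ℂ (Fun W))).IsElliptic
  rw [← Affine.equation_iff_nonsingular, Affine.equation_iff]
  exact equation_x_y W

/-- The generic point. -/
def generic (W : WeierstrassCurve ℂ) [W.IsElliptic] : FunPt W := .some (x W) (y W) generic_nonsingular

/-- The point `α` over the function field, viewed as a map from `E` to itself, is regular in the
affine sense at `P` with value `Q`. -/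
def Specializes (P : Pt W) : FunPt W → Pt W → Prop
  | .zero, .zero => True
  | .some ξ η _, .some a b _ => HasValue P ξ a ∧ HasValue P η b
  | _, _ => False

lemma specializes_constPt (P : Pt W) : ∀ Q : Pt W, Specializes P (constPt Q) Q
  | .zero => trivial
  | .some a b _ => ⟨.const P a, .const P b⟩

lemma Specializes.unique {P : Pt W} : ∀ {α : FunPt W} {Q R : Pt W}, Specializes P α Q →
    Specializes P α R → Q = R
  | .zero, .zero, .zero, _, _ => rfl
  | .some _ _ _, .some a b _, .some a' b' _, hQ, hR => by
    obtain rfl := hQ.1.unique hR.1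
    obtain rfl := hQ.2.unique hR.2
    rfl

lemma specializes_generic : ∀ {P : Pt W}, P ≠ 0 → Specializes P (generic W) P
  | .zero, h => absurd rfl h
  | .some a b h, _ => ⟨(isPlaceAt_val (.some a b h)).fst_lt, (isPlaceAt_val (.some a b h)).snd_lt⟩

section Add

variable {P : Pt W} {ξ₁ ξ₂ η₁ η₂ l : Fun W} {a₁ a₂ b₁ b₂ m : ℂ}

lemma HasValue.negY (hξ : HasValue P ξ₁ a₁) (hη : HasValue P η₁ b₁) :
    HasValue P ((Affine.baseChange W.toAffine (Fun W)).negY ξ₁ η₁) (W.toAffine.negY a₁ b₁) :=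
  (hη.neg.sub ((HasValue.const P _).mul hξ)).sub (.const P _)

lemma HasValue.addX (hξ₁ : HasValue P ξ₁ a₁) (hξ₂ : HasValue P ξ₂ a₂) (hl : HasValue P l m) :
    HasValue P ((Affine.baseChange W.toAffine (Fun W)).addX ξ₁ ξ₂ l) (W.toAffine.addX a₁ a₂ m) :=
  ((((hl.pow 2).add ((HasValue.const P _).mul hl)).sub (.const P _)).sub hξ₁).sub hξ₂

lemma HasValue.addY (hξ₁ : HasValue P ξ₁ a₁) (hξ₂ : HasValue P ξ₂ a₂) (hη₁ : HasValue P η₁ b₁)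
    (hl : HasValue P l m) : HasValue P ((Affine.baseChange W.toAffine (Fun W)).addY ξ₁ ξ₂ η₁ l)
      (W.toAffine.addY a₁ a₂ b₁ m) :=
  (hξ₁.addX hξ₂ hl).negY ((hl.mul ((hξ₁.addX hξ₂ hl).sub hξ₁)).add hη₁)

/-- Specialization commutes with addition at almost every point. -/
lemma eventually_specializes_add : ∀ α β : FunPt W, ∀ᶠ P : Pt W in cofinite, ∀ Q R : Pt W,
    Specializes P α Q → Specializes P β R → Specializes P (α + β) (Q + R)
  | .zero, β => .of_forall fun P Q R hQ hR => by
    match Q, hQ with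
    | .zero, _ =>
      have h₁ : (.zero + β : FunPt W) = β := zero_add β
      have h₂ : (.zero + R : Pt W) = R := zero_add R
      rwa [h₁, h₂]
  | .some ξ₁ η₁ h₁, .zero => .of_forall fun P Q R hQ hR => by
    match R, hR with
    | .zero, _ =>
      have h₃ : (.some ξ₁ η₁ h₁ + .zero : FunPt W) = .some ξ₁ η₁ h₁ :=
        add_zero (.some ξ₁ η₁ h₁ : FunPt W)
      have h₂ : (Q + .zero : Pt W) = Q := add_zero Q
      rwa [h₃, h₂]
  | .some ξ₁ η₁ h₁, .some ξ₂ η₂ h₂ => by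
    -- In each case of the addition law the sum is given by a rational formula. Apart from opposite
    -- points, where the sum is `O`, the slope has a nonzero denominator; the finitely many points
    -- where it vanishes are discarded, and at the others the complex points fall under the same
    -- case.
    by_cases hξ : ξ₁ = ξ₂
    · by_cases hη : η₁ = (Affine.baseChange W.toAffine (Fun W)).negY ξ₂ η₂
      · refine .of_forall fun P Q R hQ hR => ?_
        match Q, R, hQ, hR with
        | .some a₁ b₁ h₁', .some a₂ b₂ h₂', hQ, hR =>
          rw [Affine.Point.add_of_Y_eq hξ hη, Affine.Point.add_of_Y_eq]
          · trivial
          · exact hQ.1.unique (hξ ▸ hR.1)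
          · exact hQ.2.unique (hη ▸ hR.1.negY hR.2)
      · have hη₁₂ := Affine.Y_eq_of_Y_ne h₁.1 h₂.1 hξ hη
        have hne : η₁ - (Affine.baseChange W.toAffine (Fun W)).negY ξ₁ η₁ ≠ 0 := by
          rw [sub_ne_zero]
          subst hξ hη₁₂
          exact hη
        filter_upwards [eventually_not_hasValue_zero hne] with P hP Q R hQ hR
        match Q, R, hQ, hR with
        | .some a₁ b₁ h₁', .some a₂ b₂ h₂', hQ, hR =>
          obtain rfl : a₁ = a₂ := hQ.1.unique (hξ ▸ hR.1)
          obtain rfl : b₁ = b₂ := hQ.2.unique (hη₁₂ ▸ hR.2)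
          have hv := hQ.2.sub (hQ.1.negY hQ.2)
          have hb : b₁ ≠ W.toAffine.negY a₁ b₁ := by
            intro hb
            rw [← hb, sub_self] at hv
            exact hP hv
          have hl : HasValue P ((Affine.baseChange W.toAffine (Fun W)).slope ξ₁ ξ₂ η₁ η₂)
              (W.toAffine.slope a₁ a₁ b₁ b₁) := by
            rw [Affine.slope_of_Y_ne hξ hη, Affine.slope_of_Y_ne rfl hb]
            refine HasValue.div ?_ hv (sub_ne_zero.2 hb)
            have h2 : HasValue P (2 : Fun W) 2 := by
              have := HasValue.const P 2
              rwa [map_ofNat] at this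
            have h3 : HasValue P (3 : Fun W) 3 := by
              have := HasValue.const P 3
              rwa [map_ofNat] at this
            exact (((h3.mul (hQ.1.pow 2)).add ((h2.mul (.const P _)).mul hQ.1)).add
              (.const P _)).sub ((HasValue.const P _).mul hQ.2)
          rw [Affine.Point.add_some fun h => hη h.2, Affine.Point.add_some fun h => hb h.2]
          exact ⟨hQ.1.addX hR.1 hl, hQ.1.addY hR.1 hQ.2 hl⟩
    · filter_upwards [eventually_not_hasValue_zero (sub_ne_zero.2 hξ)] with P hP Q R hQ hR
      match Q, R, hQ, hR with
      | .some a₁ b₁ h₁', .some a₂ b₂ h₂', hQ, hR =>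
        have hv := hQ.1.sub hR.1
        have ha : a₁ ≠ a₂ := by
          rintro rfl
          rw [sub_self] at hv
          exact hP hv
        have hl : HasValue P ((Affine.baseChange W.toAffine (Fun W)).slope ξ₁ ξ₂ η₁ η₂)
            (W.toAffine.slope a₁ a₂ b₁ b₂) := by
          rw [Affine.slope_of_X_ne hξ, Affine.slope_of_X_ne ha]
          exact (hQ.2.sub hR.2).div hv (sub_ne_zero.2 ha)
        rw [Affine.Point.add_some fun h => hξ h.1, Affine.Point.add_some fun h => ha h.1]
        exact ⟨hQ.1.addX hR.1 hl, hQ.1.addY hR.1 hQ.2 hl⟩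

end Add

/-! ### Specialization of translates and multiples of the generic point -/

lemma eventually_specializes_generic : ∀ᶠ P : Pt W in cofinite, Specializes P (generic W) P := by
  filter_upwards [(Set.finite_singleton (0 : Pt W)).eventually_cofinite_notMem] with P hP
  exact specializes_generic hP

lemma eventually_specializes_generic_add (Q : Pt W) :
    ∀ᶠ P : Pt W in cofinite, Specializes P (generic W + constPt Q) (P + Q) := by
  filter_upwards [eventually_specializes_generic, eventually_specializes_add (generic W)
    (constPt Q)] with P h₁ h₂
  exact h₂ _ _ h₁ (specializes_constPt P Q)

lemma eventually_specializes_nsmul_generic (n : ℕ) :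
    ∀ᶠ P : Pt W in cofinite, Specializes P (n • generic W) (n • P) := by
  induction n with
  | zero =>
    refine .of_forall fun P => ?_
    rw [zero_nsmul, zero_nsmul]
    trivial
  | succ n ih =>
    filter_upwards [ih, eventually_specializes_generic, eventually_specializes_add (n • generic W)
      (generic W)] with P h₁ h₂ h₃
    rw [succ_nsmul, succ_nsmul]
    exact h₃ _ _ h₁ h₂

/-- A nonconstant point over the function field induces an endomorphism of the function field. -/
lemma exists_algHom {ξ η : Fun W} (h : (Affine.baseChange W.toAffine (Fun W)).Nonsingular ξ η)
    (hc : (.some ξ η h : FunPt W) ∉ Set.range constPt) :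
    ∃ σ : Fun W →ₐ[ℂ] Fun W, σ (x W) = ξ ∧ σ (y W) = η := by
  have h0 : (W.toAffine.polynomial).eval₂ (aeval ξ : ℂ[X] →ₐ[ℂ] Fun W).toRingHom η = 0 := by
    have hE := (Affine.equation_iff _ _).1 h.1
    have ha₁ : (Affine.baseChange W.toAffine (Fun W)).a₁ = algebraMap ℂ _ W.a₁ := rfl
    have ha₂ : (Affine.baseChange W.toAffine (Fun W)).a₂ = algebraMap ℂ _ W.a₂ := rfl
    have ha₃ : (Affine.baseChange W.toAffine (Fun W)).a₃ = algebraMap ℂ _ W.a₃ := rfl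
    have ha₄ : (Affine.baseChange W.toAffine (Fun W)).a₄ = algebraMap ℂ _ W.a₄ := rfl
    have ha₆ : (Affine.baseChange W.toAffine (Fun W)).a₆ = algebraMap ℂ _ W.a₆ := rfl
    rw [ha₁, ha₂, ha₃, ha₄, ha₆] at hE
    change eval₂ _ η (Y ^ 2 + C (C W.a₁ * X + C W.a₃) * Y -
      C (X ^ 3 + C W.a₂ * X ^ 2 + C W.a₄ * X + C W.a₆)) = 0
    simp only [eval₂_add, eval₂_mul, eval₂_sub, eval₂_pow, eval₂_X, eval₂_C, AlgHom.toRingHom_eq_coe,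
      RingHom.coe_coe, map_add, map_mul, map_pow, aeval_X, aeval_C]
    linear_combination hE
  let f : PolyFun W →+* Fun W := AdjoinRoot.lift _ η h0
  have hfX (c : ℂ) : f (Affine.CoordinateRing.XClass W.toAffine c) = ξ - algebraMap ℂ _ c := by
    change AdjoinRoot.lift _ η h0 (AdjoinRoot.mk _ (C (X - C c))) = _
    rw [AdjoinRoot.lift_mk]
    simp
  have hfY (c : ℂ) : f (Affine.CoordinateRing.YClass W.toAffine (C c)) = η - algebraMap ℂ _ c := by
    change AdjoinRoot.lift _ η h0 (AdjoinRoot.mk _ (Y - C (C c))) = _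
    rw [AdjoinRoot.lift_mk]
    simp
  -- A nonzero kernel would be the ideal of some `(a, b)`, which forces `ξ = a` and `η = b`, a
  -- constant point.
  have hinj : Function.Injective f := by
    rw [RingHom.injective_iff_ker_eq_bot]
    by_contra hbot
    obtain ⟨a, b, hab, hker⟩ := exists_eq_affineIdeal (RingHom.ker_isPrime f) hbot
    have hX : Affine.CoordinateRing.XClass W.toAffine a ∈ RingHom.ker f := by
      rw [hker]; exact Ideal.subset_span (Set.mem_insert _ _)
    have hY : Affine.CoordinateRing.YClass W.toAffine (C b) ∈ RingHom.ker f := by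
      rw [hker]; exact Ideal.subset_span (Set.mem_insert_of_mem _ rfl)
    rw [RingHom.mem_ker, hfX, sub_eq_zero] at hX
    rw [RingHom.mem_ker, hfY, sub_eq_zero] at hY
    refine hc ⟨.some a b hab, ?_⟩
    rw [constPt, Affine.Point.some.injEq]
    exact ⟨hX.symm, hY.symm⟩
  let g : Fun W →+* Fun W := IsFractionRing.lift hinj
  have hg (r : PolyFun W) : g (algebraMap _ _ r) = f r := IsFractionRing.lift_algebraMap hinj r
  refine ⟨{ g with commutes' := fun c => ?_ }, ?_, ?_⟩
  · change g (algebraMap ℂ (Fun W) c) = _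
    rw [IsScalarTower.algebraMap_apply ℂ (PolyFun W) (Fun W), hg,
      ← IsScalarTower.algebraMap_apply ℂ (PolyFun W) (Fun W)]
    change AdjoinRoot.lift _ η h0 (AdjoinRoot.mk _ (C (C c))) = _
    rw [AdjoinRoot.lift_mk]
    simp
  · have := hfX 0
    rw [← hg, algebraMap_XClass, map_zero, sub_zero, sub_zero] at this
    exact this
  · have := hfY 0
    rw [← hg, algebraMap_YClass, map_zero, sub_zero, sub_zero] at this
    exact this

/-! ### Translations -/

lemma exists_algHom_generic {α : FunPt W} (hc : α ∉ Set.range constPt) :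
    ∃ σ : Fun W →ₐ[ℂ] Fun W, Affine.Point.map (W' := W.toAffine) σ (generic W) = α := by
  match α with
  | .zero => exact absurd ⟨0, rfl⟩ hc
  | .some ξ η h =>
    obtain ⟨σ, hx, hy⟩ := exists_algHom h hc
    refine ⟨σ, ?_⟩
    rw [generic, Affine.Point.map_some, Affine.Point.some.injEq]
    exact ⟨hx, hy⟩

/-- Otherwise `P + P₀` would be the same point for almost all `P`, although `E(ℂ)` is infinite. -/
lemma generic_add_notMem_range (P₀ : Pt W) : generic W + constPt P₀ ∉ Set.range constPt := by
  rintro ⟨Q, hQ⟩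
  obtain ⟨P, h₁, h₂⟩ := ((eventually_specializes_generic_add P₀).and
    (Set.finite_singleton (Q - P₀)).eventually_cofinite_notMem).exists
  rw [← hQ] at h₁
  exact h₂ (eq_sub_of_add_eq (h₁.unique (specializes_constPt P Q)))

/-- The pullback of functions along a translation, as an automorphism of the function field. -/
lemma exists_translation_algEquiv (P₀ : Pt W) : ∃ σ : Fun W ≃ₐ[ℂ] Fun W,
    Affine.Point.map (W' := W.toAffine) (σ : Fun W →ₐ[ℂ] Fun W) (generic W) =
      generic W + constPt P₀ := by
  -- The pullbacks along `P₀` and `-P₀` are mutually inverse, since their composite fixes the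
  -- generic point.
  have key (P₀ : Pt W) (σ τ : Fun W →ₐ[ℂ] Fun W)
      (hσ : Affine.Point.map (W' := W.toAffine) σ (generic W) = generic W + constPt P₀)
      (hτ : Affine.Point.map (W' := W.toAffine) τ (generic W) = generic W + constPt (-P₀)) :
      σ.comp τ = AlgHom.id ℂ (Fun W) := by
    have h := Affine.Point.map_map (W' := W.toAffine) τ σ (generic W)
    rw [hτ, map_add, hσ, map_constPt, constPt_neg, add_neg_cancel_right, generic,
      Affine.Point.map_some, Affine.Point.some.injEq] at h
    exact algHom_ext h.1.symm h.2.symm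
  obtain ⟨σ, hσ⟩ := exists_algHom_generic (generic_add_notMem_range P₀)
  obtain ⟨τ, hτ⟩ := exists_algHom_generic (generic_add_notMem_range (-P₀))
  exact ⟨AlgEquiv.ofAlgHom σ τ (key P₀ σ τ hσ hτ) (key (-P₀) τ σ hτ (by rwa [neg_neg])), hσ⟩

/-- Translations of functions: the function `P ↦ φ (P + P₀)` is rational. -/
lemma exists_translation (P₀ : Pt W) : ∃ σ : Fun W ≃ₐ[ℂ] Fun W,
    ∀ (P : Pt W) (φ : Fun W), val P (σ φ) = val (P + P₀) φ := by
  obtain ⟨σ, hσ⟩ := exists_translation_algEquiv P₀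
  refine ⟨σ, ?_⟩
  -- An automorphism over `ℂ` carries places to places, so `σ` induces a permutation `T` of the
  -- points; the aim is `T P = P + P₀`.
  have hplace (τ : Fun W ≃ₐ[ℂ] Fun W) (P : Pt W) :
      ∃ Q : Pt W, IsPlaceAt ((val P).comap (τ : Fun W →+* Fun W)) Q := by
    refine exists_isPlaceAt (fun c => ?_) ?_
    · change val P (τ (algebraMap ℂ _ c)) ≤ 1
      rw [τ.commutes]
      exact (isPlaceAt_val P).const_le c
    · obtain ⟨ϖ, hϖ⟩ := (isPlaceAt_val P).exists_uniformizer
      refine ⟨τ.symm ϖ, ?_⟩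
      change val P (τ (τ.symm ϖ)) = _
      rw [τ.apply_symm_apply, hϖ]
  choose T hT using hplace σ
  have hval (P : Pt W) (φ : Fun W) : val P (σ φ) = val (T P) φ :=
    DFunLike.congr_fun (hT P).eq_val φ
  have hinj : Function.Injective T := by
    intro P Q hPQ
    have : val P = val Q := by
      ext φ
      rw [← σ.apply_symm_apply φ, hval, hval, hPQ]
    exact (isPlaceAt_val P).point_eq (this ▸ isPlaceAt_val Q)
  have hsurj : Function.Surjective T := by
    intro Q
    obtain ⟨P, hP⟩ := hplace σ.symm Q
    refine ⟨P, (hT P).point_eq ?_⟩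
    convert isPlaceAt_val Q using 1
    ext φ
    change val P (σ φ) = _
    rw [← hP.eq_val]
    change val Q (σ.symm (σ φ)) = _
    rw [σ.symm_apply_apply]
  -- Specializing the coordinates of the translated generic point settles all but finitely many `P`.
  have hgen : ∀ᶠ P : Pt W in cofinite, T P = P + P₀ := by
    filter_upwards [eventually_specializes_generic_add P₀] with P hP
    refine (hT P).point_eq ?_
    rw [← hσ, generic, Affine.Point.map_some] at hP
    generalize P + P₀ = Q at hP ⊢
    match Q, hP with
    | .some a b h, hP =>
      refine ⟨(hT P).const_le, ?_, ?_, (hT P).exists_uniformizer⟩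
      · have h1 := hP.1
        rw [HasValue, ← σ.commutes] at h1
        change val P (σ (x W - algebraMap ℂ _ a)) < 1
        rw [map_sub]
        exact h1
      · have h1 := hP.2
        rw [HasValue, ← σ.commutes] at h1
        change val P (σ (y W - algebraMap ℂ _ b)) < 1
        rw [map_sub]
        exact h1
  suffices hT' : ∀ P, T P = P + P₀ from fun P φ => by rw [hval, hT']
  -- For an arbitrary `P`, choose `Q`, `R`, `S` among the settled points with `P + Q = R + S`. Then
  -- `(P) + (Q) - (R) - (S)` is principal, and so is its image under `T`; hence `T P + T Q = T R + T
  -- S`, which determines `T P`.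
  intro P
  obtain ⟨R, hR⟩ := hgen.exists
  have hS : Tendsto (fun Q => P + Q - R) cofinite cofinite :=
    Function.Injective.tendsto_cofinite fun Q Q' h => by simpa using h
  obtain ⟨Q, hQ, hS⟩ := (hgen.and (hS.eventually hgen)).exists
  set S := P + Q - R with hSdef
  let D : Pt W →₀ ℤ := Finsupp.single P 1 + Finsupp.single Q 1 - Finsupp.single R 1 -
    Finsupp.single S 1
  obtain ⟨φ, hφ, hD⟩ := exists_divisor_eq (D := D)
    (by
      rw [← degree_apply]
      simp only [D, map_add, map_sub, degree_single]
      norm_num)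
    (by
      rw [← pointSum_apply]
      simp only [D, map_add, map_sub, pointSum_single, one_smul, hSdef]
      abel)
  have hψ : divisor (σ.symm φ) = Finsupp.mapDomain T D := by
    ext Z
    obtain ⟨Z, rfl⟩ := hsurj Z
    rw [Finsupp.mapDomain_apply hinj, ← hD, divisor_apply, divisor_apply, ← hval,
      σ.apply_symm_apply]
  have hsum := sum_divisor_smul (φ := σ.symm φ) ((map_ne_zero_iff _ σ.symm.injective).2 hφ)
  rw [hψ, ← pointSum_apply] at hsum
  simp only [D, Finsupp.mapDomain_add, Finsupp.mapDomain_sub, Finsupp.mapDomain_single, map_add,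
    map_sub, pointSum_single, one_smul] at hsum
  rw [hQ, hR, hS, hSdef, sub_sub, sub_eq_zero, ← eq_sub_iff_add_eq] at hsum
  rw [hsum]
  abel

/-! ### Divisibility of the group of points -/

/-- If `n • P` is constant for almost all `P`, then for any `P` some `Q` has both `Q` and `P + Q` in
this set, and subtracting gives `n • P = 0`. -/
lemma nsmul_eq_zero_of_mem_range {n : ℕ} (h : n • generic W ∈ Set.range constPt) (P : Pt W) :
    n • P = 0 := by
  obtain ⟨c, hc⟩ := h
  have hev : ∀ᶠ P : Pt W in cofinite, n • P = c := by
    filter_upwards [eventually_specializes_nsmul_generic n] with P hP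
    rw [← hc] at hP
    exact hP.unique (specializes_constPt P c)
  obtain ⟨Q, hQ, hPQ⟩ := (hev.and ((add_right_injective P).tendsto_cofinite.eventually hev)).exists
  rwa [nsmul_add, hQ, add_eq_right] at hPQ

/-- The abscissa is a root of the 2-division polynomial, and the ordinate is the one fixed by
negation. -/
lemma exists_two_torsion : ∃ P : Pt W, P ≠ 0 ∧ 2 • P = 0 := by
  obtain ⟨a, ha⟩ := IsAlgClosed.exists_root
    (C 4 * X ^ 3 + C W.b₂ * X ^ 2 + C (2 * W.b₄) * X + C W.b₆ : ℂ[X])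
    (by rw [degree_cubic (by norm_num)]; norm_num)
  simp only [IsRoot.def, eval_add, eval_mul, eval_C, eval_pow, eval_X, b₂, b₄, b₆] at ha
  have hE : W.toAffine.Equation a (-(W.a₁ * a + W.a₃) / 2) := by
    rw [Affine.equation_iff]
    linear_combination -ha / 4
  refine ⟨.some _ _ (Affine.equation_iff_nonsingular.1 hE), Affine.Point.some_ne_zero _, ?_⟩
  rw [two_smul, Affine.Point.add_self_of_Y_eq]
  rw [Affine.negY]
  ring

/-- The function `2 y + a₁ x + a₃` is not zero, yet it vanishes at every affine point with `P = -P`.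
-/
lemma exists_two_smul_ne_zero : ∃ P : Pt W, 2 • P ≠ 0 := by
  by_contra! h
  set ψ : Fun W := y W - (Affine.baseChange W.toAffine (Fun W)).negY (x W) (y W) with hψ
  have hne : ψ ≠ 0 := by
    have h2 : ψ = algebraMap (PolyFun W) (Fun W) ((C W.a₁ * X + C W.a₃ : ℂ[X]) • 1 +
        (C 2 : ℂ[X]) • Affine.CoordinateRing.mk W.toAffine Y) := by
      rw [Affine.CoordinateRing.smul, Affine.CoordinateRing.smul, mul_one, ← map_mul, ← map_add,
        ← polyHom_apply]
      simp only [map_add, map_mul]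
      have hx : polyHom W (C X) = x W := rfl
      have hy : polyHom W Y = y W := rfl
      have hc (c : ℂ) : polyHom W (C (C c)) = algebraMap ℂ _ c := (polyHom W).commutes c
      have h2 : algebraMap ℂ (Fun W) 2 = 2 := map_ofNat _ 2
      rw [hx, hy, hc, hc, hc, h2, hψ, Affine.negY]
      change _ - (_ - algebraMap ℂ _ W.a₁ * _ - algebraMap ℂ _ W.a₃) = _
      ring
    rw [h2]
    refine algebraMap_polyFun_ne_zero fun h0 => ?_
    have := (Affine.CoordinateRing.smul_basis_eq_zero h0).2
    rw [C_eq_zero] at this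
    norm_num at this
  obtain ⟨P, hP, h0⟩ := ((eventually_not_hasValue_zero hne).and
    (Set.finite_singleton (0 : Pt W)).eventually_cofinite_notMem).exists
  match P, hP, h0 with
  | .zero, _, h0 => exact h0 rfl
  | .some a b hab, hP, _ =>
    have h2 := h (.some a b hab)
    rw [two_smul, add_eq_zero_iff_eq_neg, Affine.Point.neg_some, Affine.Point.some.injEq] at h2
    have hab' := isPlaceAt_val (.some a b hab : Pt W)
    have hx : HasValue (.some a b hab : Pt W) (x W) a := hab'.fst_lt
    have hy : HasValue (.some a b hab : Pt W) (y W) b := hab'.snd_lt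
    have := hy.sub (hx.negY hy)
    rw [← h2.2, sub_self] at this
    exact hP this

/-- Otherwise `p` would kill all of `E(ℂ)`. For `p = 2` some point is not 2-torsion; for odd `p` a
point of order two survives. -/
lemma prime_smul_generic_notMem_range {p : ℕ} (hp : p.Prime) :
    p • generic W ∉ Set.range constPt := by
  intro h
  have h0 := nsmul_eq_zero_of_mem_range h
  rcases hp.eq_two_or_odd' with rfl | ⟨k, rfl⟩
  · obtain ⟨P, hP⟩ := exists_two_smul_ne_zero (W := W)
    exact hP (h0 P)
  · obtain ⟨P, hP, hP2⟩ := exists_two_torsion (W := W)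
    have := h0 P
    rw [add_nsmul, mul_nsmul, hP2, nsmul_zero, one_nsmul, zero_add] at this
    exact hP this

/-- The abscissa `ξ` of `p` times the generic point is nonconstant, so it takes the value `x(Q)` at
some `P`. Then `p • P = ±Q`, and the sign is absorbed in `P`. -/
lemma prime_smul_surjective {p : ℕ} (hp : p.Prime) (Q : Pt W) : ∃ P : Pt W, p • P = Q := by
  -- Almost all points suffice: some `R` has both `R` and `Q + R` in the image, and `Q` is their
  -- difference.
  suffices hev : ∀ᶠ Q : Pt W in cofinite, ∃ P : Pt W, p • P = Q by
    obtain ⟨R, ⟨P, hP⟩, P', hP'⟩ :=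
      (hev.and ((add_right_injective Q).tendsto_cofinite.eventually hev)).exists
    exact ⟨P' - P, by rw [nsmul_sub, hP, hP', add_sub_cancel_right]⟩
  have hnr := prime_smul_generic_notMem_range (W := W) hp
  have hspec := eventually_specializes_nsmul_generic (W := W) p
  generalize p • generic W = α at hnr hspec
  match α with
  | .zero => exact absurd ⟨0, rfl⟩ hnr
  | .some ξ η h =>
    obtain ⟨σ, hσ, -⟩ := exists_algHom h hnr
    have hξ : ξ ∉ Set.range (algebraMap ℂ (Fun W)) := by
      rintro ⟨c, hc⟩
      refine x_notMem_range (W := W) ⟨c, (σ : Fun W →+* Fun W).injective ?_⟩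
      change σ _ = σ _
      rw [σ.commutes, hσ, hc]
    rw [eventually_cofinite] at hspec
    -- The points `Q` to avoid are `O` and those with `x(Q) = ξ(P)` for one of the finitely many `P`
    -- where specialization fails.
    have hfin (P : Pt W) : {Q : Pt W | ∃ c, HasValue P ξ c ∧ HasValue Q (x W) c}.Finite := by
      by_cases hP : ∃ c, HasValue P ξ c
      · obtain ⟨c, hc⟩ := hP
        have hx : x W - algebraMap ℂ _ c ≠ 0 := fun h0 =>
          x_notMem_range (W := W) ⟨c, (sub_eq_zero.1 h0).symm⟩
        refine (finite_hasValue_zero hx).subset ?_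
        rintro Q ⟨d, hd, hQ⟩
        obtain rfl := hc.unique hd
        have := hQ.sub (HasValue.const Q c)
        rwa [sub_self] at this
      · convert Set.finite_empty
        ext Q
        simp only [Set.mem_ofPred_eq, Set.mem_empty_iff_false, iff_false]
        rintro ⟨c, hc, -⟩
        exact hP ⟨c, hc⟩
    have hbad := (hspec.biUnion fun P _ => hfin P).insert 0
    filter_upwards [hbad.eventually_cofinite_notMem] with Q hQ
    match Q, hQ with
    | .zero, hQ => exact absurd (Set.mem_insert _ _) hQ
    | .some a b hab, hQ =>
      obtain ⟨P, hP⟩ := exists_hasValue hξ a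
      have hx : HasValue (.some a b hab : Pt W) (x W) a := (isPlaceAt_val (.some a b hab)).fst_lt
      have hs : Specializes P (.some ξ η h) (p • P) := by
        by_contra hs
        exact hQ (Set.mem_insert_of_mem _ (Set.mem_biUnion hs ⟨a, hP, hx⟩))
      have hPQ : p • P = .some a b hab ∨ p • P = -.some a b hab := by
        generalize p • P = R at hs
        match R, hs with
        | .some a' b' hab', hs =>
          exact Affine.Point.X_eq_iff.1 (hs.1.unique hP)
      rcases hPQ with h | h
      · exact ⟨P, h⟩
      · exact ⟨-P, by rw [neg_nsmul, h, neg_neg]⟩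

/-- The group of complex points is divisible. -/
lemma nsmul_surjective {n : ℕ} (hn : n ≠ 0) (Q : Pt W) : ∃ P : Pt W, n • P = Q := by
  induction n using induction_on_primes generalizing Q with
  | zero => exact absurd rfl hn
  | one => exact ⟨Q, one_nsmul Q⟩
  | prime_mul p n hp ih =>
    obtain ⟨R, hR⟩ := prime_smul_surjective hp Q
    obtain ⟨P, hP⟩ := ih (right_ne_zero_of_mul hn) R
    exact ⟨P, by rw [mul_nsmul', hP, hR]⟩

end ToroidalBelyi
end

open WeierstrassCurve

noncomputable section

namespace ToroidalBelyi

open WithZero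

variable {W : WeierstrassCurve ℂ}

/-! ### Translation of divisors -/

lemma degree_mapDomain (D : Pt W →₀ ℤ) (f : Pt W → Pt W) :
    degree W (D.mapDomain f) = degree W D := by
  induction D using Finsupp.induction_linear with
  | zero => simp
  | add D D' h h' => rw [Finsupp.mapDomain_add, map_add, map_add, h, h']
  | single P n => rw [Finsupp.mapDomain_single, degree_single, degree_single]

lemma pointSum_mapDomain_sub (D : Pt W →₀ ℤ) (P₀ : Pt W) :
    pointSum W (D.mapDomain fun P => P - P₀) = pointSum W D - degree W D • P₀ := by
  induction D using Finsupp.induction_linear with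
  | zero => simp
  | add D D' h h' => rw [Finsupp.mapDomain_add, map_add, map_add, map_add, h, h', add_zsmul]; abel
  | single P n =>
    rw [Finsupp.mapDomain_single, pointSum_single, pointSum_single, degree_single, zsmul_sub]

lemma mapDomain_sub_apply (D : Pt W →₀ ℤ) (P₀ P : Pt W) :
    D.mapDomain (fun P => P - P₀) P = D (P + P₀) := by
  conv_lhs => rw [← add_sub_cancel_right P P₀]
  exact Finsupp.mapDomain_apply (f := fun P => P - P₀) sub_left_injective D (P + P₀)

/-! ### Fibres -/

lemma sub_const_ne_zero {φ : Fun W} (hφ : φ ∉ Set.range (algebraMap ℂ (Fun W))) (c : ℂ) :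
    φ - algebraMap ℂ (Fun W) c ≠ 0 := fun h =>
  hφ ⟨c, (sub_eq_zero.1 h).symm⟩

lemma ne_zero_of_nonconstant {φ : Fun W} (hφ : φ ∉ Set.range (algebraMap ℂ (Fun W))) :
    φ ≠ 0 := fun h => hφ ⟨0, by rw [map_zero, h]⟩

variable [W.IsElliptic]

lemma divisor_pos_iff {φ : Fun W} (hφ : φ ≠ 0) (P : Pt W) : 0 < divisor φ P ↔ val P φ < 1 := by
  rw [val_eq_exp hφ, ← exp_zero, exp_lt_exp]
  omega

lemma divisor_neg_iff {φ : Fun W} (hφ : φ ≠ 0) (P : Pt W) : divisor φ P < 0 ↔ 1 < val P φ := by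
  rw [val_eq_exp hφ, ← exp_zero, exp_lt_exp]
  omega

/-- A function whose zeros are the points where `φ` takes the value `q`. -/
def fiberFun (φ : Fun W) : OnePoint ℂ → Fun W
  | OnePoint.infty => φ⁻¹
  | OnePoint.some c => φ - algebraMap ℂ (Fun W) c

/-- The fibre of `φ` over `q`, with multiplicities. -/
def fiberDivisor (φ : Fun W) (q : OnePoint ℂ) : Pt W →₀ ℤ :=
  (divisor (fiberFun φ q)).mapRange (fun n => max n 0) rfl

lemma fiberDivisor_apply (φ : Fun W) (q : OnePoint ℂ) (P : Pt W) :
    fiberDivisor φ q P = max (divisor (fiberFun φ q) P) 0 := rfl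

lemma fiberDivisor_nonneg (φ : Fun W) (q : OnePoint ℂ) (P : Pt W) : 0 ≤ fiberDivisor φ q P :=
  le_max_right _ _

section Nonconstant

variable {φ : Fun W} (hφ : φ ∉ Set.range (algebraMap ℂ (Fun W)))

include hφ

lemma mem_fiber_iff (q : OnePoint ℂ) (P : Pt W) :
    P ∈ fiber φ q ↔ 0 < divisor (fiberFun φ q) P := by
  match q with
  | OnePoint.infty =>
    change value φ P = _ ↔ 0 < divisor φ⁻¹ P
    rw [(isPlaceAt_val P).value_eq_infty_iff, ← divisor_neg_iff (ne_zero_of_nonconstant hφ),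
      divisor_inv, Finsupp.neg_apply, neg_pos]
  | OnePoint.some c =>
    change value φ P = _ ↔ 0 < divisor (φ - algebraMap ℂ _ c) P
    rw [(isPlaceAt_val P).value_eq_some_iff, divisor_pos_iff (sub_const_ne_zero hφ c)]

lemma mem_fiber_iff' (q : OnePoint ℂ) (P : Pt W) :
    P ∈ fiber φ q ↔ P ∈ (fiberDivisor φ q).support := by
  rw [mem_fiber_iff hφ, Finsupp.mem_support_iff, fiberDivisor_apply]
  omega

lemma ramificationIndex_eq {q : OnePoint ℂ} {P : Pt W} (hP : P ∈ fiber φ q) :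
    ramificationIndex φ P = fiberDivisor φ q P := by
  have h : ramificationIndex φ P = divisor (fiberFun φ q) P := by
    have hv : value φ P = q := hP
    rw [ramificationIndex, hv]
    match q with
    | OnePoint.infty => exact ord_eq_divisor _ _
    | OnePoint.some c => exact ord_eq_divisor _ _
  rw [h, fiberDivisor_apply, max_eq_left ((mem_fiber_iff hφ q P).1 hP).le]

lemma fiber_eq_support (q : OnePoint ℂ) : fiber φ q = ↑(fiberDivisor φ q).support :=
  Set.ext fun P => (mem_fiber_iff' hφ q P).trans Finset.mem_coe.symm

lemma fiber_finite (q : OnePoint ℂ) : (fiber φ q).Finite := by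
  rw [fiber_eq_support hφ]
  exact Finset.finite_toSet _

/-- Constants have valuation at most `1`, so `φ - c` and `φ` have the same poles with the same
orders. -/
lemma divisor_sub_const (c : ℂ) : divisor (φ - algebraMap ℂ (Fun W) c) =
    fiberDivisor φ (OnePoint.some c) - fiberDivisor φ OnePoint.infty := by
  ext P
  rw [Finsupp.sub_apply, fiberDivisor_apply, fiberDivisor_apply]
  change _ = max (divisor (φ - algebraMap ℂ _ c) P) 0 - max (divisor φ⁻¹ P) 0
  rw [divisor_inv, Finsupp.neg_apply]
  have h0 := ne_zero_of_nonconstant hφ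
  have hc := sub_const_ne_zero hφ c
  have hcle := (isPlaceAt_val P).const_le c
  by_cases h : divisor (φ - algebraMap ℂ _ c) P < 0
  · have h1 := (divisor_neg_iff hc P).1 h
    have h2 : val P φ = val P (φ - algebraMap ℂ _ c) := by
      have := (val P).map_add_eq_of_lt_right (hcle.trans_lt h1)
      rwa [add_sub_cancel] at this
    have h3 : divisor φ P = divisor (φ - algebraMap ℂ _ c) P := by
      rw [divisor_apply, divisor_apply, h2]
    omega
  · have h1 : ¬divisor φ P < 0 := by
      rw [divisor_neg_iff hc, not_lt] at h
      rw [divisor_neg_iff h0, not_lt]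
      have := (val P).map_add_le h hcle
      rwa [sub_add_cancel] at this
    omega

lemma degree_fiberDivisor (q : OnePoint ℂ) :
    degree W (fiberDivisor φ q) = degree W (fiberDivisor φ OnePoint.infty) := by
  match q with
  | OnePoint.infty => rfl
  | OnePoint.some c =>
    have := sum_divisor (sub_const_ne_zero hφ c)
    rwa [← degree_apply, divisor_sub_const hφ, map_sub, sub_eq_zero] at this

lemma pointSum_fiberDivisor (q : OnePoint ℂ) :
    pointSum W (fiberDivisor φ q) = pointSum W (fiberDivisor φ OnePoint.infty) := by
  match q with
  | OnePoint.infty => rfl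
  | OnePoint.some c =>
    have := sum_divisor_smul (sub_const_ne_zero hφ c)
    rwa [← pointSum_apply, divisor_sub_const hφ, map_sub, sub_eq_zero] at this

lemma fiberSum_eq (q : OnePoint ℂ) : fiberSum φ q = pointSum W (fiberDivisor φ q) := by
  rw [fiberSum, pointSum_apply, Finsupp.sum, ← finsum_mem_coe_finset, ← fiber_eq_support hφ]
  exact finsum_mem_congr rfl fun P hP => by rw [ramificationIndex_eq hφ hP]

lemma degree_pos : 0 < degree W (fiberDivisor φ OnePoint.infty) := by
  obtain ⟨P, hP⟩ := exists_hasValue hφ 0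
  have hP' : P ∈ fiber φ (OnePoint.some 0) := HasValue.iff_value.1 hP
  rw [mem_fiber_iff' hφ, Finsupp.mem_support_iff] at hP'
  rw [← degree_fiberDivisor hφ (OnePoint.some 0), degree_apply]
  exact Finset.sum_pos' (fun P _ => fiberDivisor_nonneg _ _ P)
    ⟨P, Finsupp.mem_support_iff.2 hP', lt_of_le_of_ne (fiberDivisor_nonneg _ _ P) hP'.symm⟩

/-- Over a value that is not critical all ramification indices are `1`, so counting points gives the
degree of the fibre divisor, which is independent of the value. -/
lemma degree_eq_of_hasDegree {N : ℕ} (hN : HasDegree φ N) (q : OnePoint ℂ) :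
    degree W (fiberDivisor φ q) = N := by
  obtain ⟨q', hq', rfl⟩ := hN
  rw [degree_fiberDivisor hφ, ← degree_fiberDivisor hφ q', degree_apply, fiber_eq_support hφ,
    Set.ncard_coe_finset, Finset.card_eq_sum_ones, Nat.cast_sum]
  refine Finset.sum_congr rfl fun P hP => ?_
  have hP' := (mem_fiber_iff' hφ q' P).2 hP
  have h1 : ¬2 ≤ ramificationIndex φ P := fun h => hq' ⟨P, h, hP'⟩
  rw [ramificationIndex_eq hφ hP'] at h1
  have h2 := fiberDivisor_nonneg φ q' P
  rw [Finsupp.mem_support_iff] at hP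
  push_cast
  omega

lemma translatedFiberDivisor_eq (q : OnePoint ℂ) (P₀ : Pt W) (N : ℕ) :
    translatedFiberDivisor φ q P₀ N =
      (fiberDivisor φ q).mapDomain (fun P => P - P₀) - Finsupp.single 0 (N : ℤ) := by
  rw [translatedFiberDivisor, finsum_mem_image (sub_left_injective).injOn, Finsupp.mapDomain,
    Finsupp.sum, ← finsum_mem_coe_finset, ← fiber_eq_support hφ]
  congr 1
  exact finsum_mem_congr rfl fun P hP => by rw [sub_add_cancel, ramificationIndex_eq hφ hP]

end Nonconstant

end ToroidalBelyi

end

/-! ### Construction of `P₀`, `f` and `g` -/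

open ToroidalBelyi in
theorem mainTheorem2 (W : WeierstrassCurve ℂ) [W.IsElliptic] (β : ToroidalBelyi.Fun W)
    (hβ : ToroidalBelyi.IsBelyiMap β) (N : ℕ) (hN : ToroidalBelyi.HasDegree β N) :
    (∀ q : OnePoint ℂ, (ToroidalBelyi.fiber β q).Finite) ∧
    ∃ Q₀ : ToroidalBelyi.Pt W,
      Q₀ = ToroidalBelyi.fiberSum β (OnePoint.some 0) ∧
      Q₀ = ToroidalBelyi.fiberSum β (OnePoint.some 1) ∧
      Q₀ = ToroidalBelyi.fiberSum β OnePoint.infty ∧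
      ∃ P₀ : ToroidalBelyi.Pt W, N • P₀ = Q₀ ∧
        ∃ f g : ToroidalBelyi.PolyFun W,
          (∀ P : ToroidalBelyi.Pt W,
            ToroidalBelyi.value β (P + P₀) =
              ToroidalBelyi.value
                (algebraMap _ (ToroidalBelyi.Fun W) f / algebraMap _ (ToroidalBelyi.Fun W) g) P) ∧
          ToroidalBelyi.HasDivisor (algebraMap _ (ToroidalBelyi.Fun W) f)
            (ToroidalBelyi.translatedFiberDivisor β (OnePoint.some 0) P₀ N) ∧
          ToroidalBelyi.HasDivisor (algebraMap _ (ToroidalBelyi.Fun W) (f - g))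
            (ToroidalBelyi.translatedFiberDivisor β (OnePoint.some 1) P₀ N) ∧
          ToroidalBelyi.HasDivisor (algebraMap _ (ToroidalBelyi.Fun W) g)
            (ToroidalBelyi.translatedFiberDivisor β OnePoint.infty P₀ N) := by
  have hφ := hβ.1
  refine ⟨fiber_finite hφ, fiberSum β OnePoint.infty, ?_, ?_, rfl, ?_⟩
  · rw [fiberSum_eq hφ, fiberSum_eq hφ, pointSum_fiberDivisor hφ (OnePoint.some 0)]
  · rw [fiberSum_eq hφ, fiberSum_eq hφ, pointSum_fiberDivisor hφ (OnePoint.some 1)]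
  have hdeg := degree_eq_of_hasDegree hφ hN
  have hN0 : N ≠ 0 := by
    have := degree_pos hφ
    rw [hdeg] at this
    omega
  obtain ⟨P₀, hP₀⟩ := nsmul_surjective hN0 (fiberSum β OnePoint.infty)
  refine ⟨P₀, hP₀, ?_⟩
  obtain ⟨σ, hσ⟩ := exists_translation P₀
  set E : OnePoint ℂ → Pt W →₀ ℤ := fun q =>
    (fiberDivisor β q).mapDomain (fun P => P - P₀) - Finsupp.single 0 (N : ℤ) with hE
  have hEpos (q : OnePoint ℂ) (P : Pt W) (hP : P ≠ 0) : 0 ≤ E q P := by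
    simp only [hE]
    rw [Finsupp.sub_apply, Finsupp.single_eq_of_ne hP, sub_zero, mapDomain_sub_apply]
    exact fiberDivisor_nonneg _ _ _
  have hdiv (c : ℂ) : divisor (σ β - algebraMap ℂ (Fun W) c) =
      -- The terms `N (O)` cancel in this difference.
      E (OnePoint.some c) - E OnePoint.infty := by
    have hs : σ β - algebraMap ℂ (Fun W) c = σ (β - algebraMap ℂ (Fun W) c) := by
      rw [map_sub, σ.commutes]
    simp only [hE]
    rw [sub_sub_sub_cancel_right]
    ext P
    rw [Finsupp.sub_apply, mapDomain_sub_apply, mapDomain_sub_apply, ← Finsupp.sub_apply,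
      ← divisor_sub_const hφ, divisor_apply, divisor_apply, ← hσ, hs]
  have hne (c : ℂ) : σ β - algebraMap ℂ (Fun W) c ≠ 0 := by
    rw [← σ.commutes c, ← map_sub]
    exact (map_ne_zero_iff _ σ.injective).2 (sub_const_ne_zero hφ c)
  -- The degree is `N - N = 0` and the sum of the points is `Q₀ - N P₀ = 0`.
  obtain ⟨g', hg', hgdiv⟩ := exists_divisor_eq (D := E OnePoint.infty)
    (by
      simp only [hE]
      rw [← degree_apply, map_sub, degree_mapDomain, hdeg, degree_single, sub_self])
    (by
      simp only [hE]
      rw [← pointSum_apply, map_sub, pointSum_mapDomain_sub, hdeg, pointSum_single, zsmul_zero,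
        sub_zero, ← fiberSum_eq hφ, ← hP₀, natCast_zsmul, sub_self])
  have hfdiv (c : ℂ) : divisor ((σ β - algebraMap ℂ (Fun W) c) * g') = E (OnePoint.some c) := by
    rw [divisor_mul (hne c) hg', hdiv, hgdiv, sub_add_cancel]
  obtain ⟨g, hg⟩ := exists_polyFun_eq (φ := g') fun P hP => by
    rw [hgdiv]
    exact hEpos _ P hP
  -- The constant `0` is kept so that the general formula for `(σ β - c) g'` applies; `f - g` is the
  -- case `c = 1`.
  obtain ⟨f, hf⟩ := exists_polyFun_eq (φ := (σ β - algebraMap ℂ (Fun W) 0) * g') fun P hP => by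
    rw [hfdiv]
    exact hEpos _ P hP
  have hfg : algebraMap (PolyFun W) (Fun W) (f - g) = (σ β - algebraMap ℂ (Fun W) 1) * g' := by
    rw [map_sub, hf, hg, map_zero, map_one]
    ring
  refine ⟨f, g, fun P => ?_, ⟨?_, fun P => ?_⟩, ⟨?_, fun P => ?_⟩, ⟨?_, fun P => ?_⟩⟩
  · rw [hf, hg, mul_div_cancel_right₀ _ hg', map_zero, sub_zero]
    have hQ := isPlaceAt_val (P + P₀)
    match h : value β (P + P₀) with
    | OnePoint.infty =>
      have h' : value β (P + P₀) = OnePoint.infty := h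
      rw [hQ.value_eq_infty_iff, ← hσ] at h'
      exact ((isPlaceAt_val P).value_eq_infty_iff.2 h').symm
    | OnePoint.some c =>
      have h' : value β (P + P₀) = OnePoint.some c := h
      rw [hQ.value_eq_some_iff, ← hσ, map_sub, σ.commutes] at h'
      exact ((isPlaceAt_val P).value_eq_some_iff.2 h').symm
  · rw [hf]
    exact mul_ne_zero (hne 0) hg'
  · rw [hf, ord_eq_divisor, hfdiv, translatedFiberDivisor_eq hφ]
  · rw [hfg]
    exact mul_ne_zero (hne 1) hg'
  · rw [hfg, ord_eq_divisor, hfdiv, translatedFiberDivisor_eq hφ]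
  · rwa [hg]
  · rw [hg, ord_eq_divisor, hgdiv, translatedFiberDivisor_eq hφ]
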